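/- **Setting.** Let $D$ be an unknown distribution on $[N]=\{1,\dots,N\}$, $N\ge 1$, let $\mathcal U$ be the uniform distribution on $[N]$, and $d_{\rm TV}(D,\mathcal U)=\frac12\sum_{i}|D(i)-\frac1N|$. A SAMP query returns a draw from $D$. A PCOND query on a set $\{i,j\}$, $i\ne j$, returns a draw from $D$ conditioned on $\{i,j\}$ (if $D(\{i,j\})=0$ the algorithm fails and stops). All answers are independent. Choosing internal random values, such as uniform points of $[N]$, costs no query. Samples are multisets, and $\log$ is the natural logarithm. In each of the five sample sizes below, $\Theta(f)$ stands for $\lceil c f\rceil$ with its own absolute constant $c>0$. **Compare**$(x,y,\eta,K,\delta)$. If $x=y$, return the value $1$ without a query. Otherwise make $\Theta(K\log(1/\delta)/\eta^2)$ PCOND queries on $\{x,y\}$ and let $\hat\mu$ be the fraction of answers equal to $y$. If $\hat\mu<\frac23\cdot\frac1{K+1}$ return Low; else if $1-\hat\mu<\frac23\cdot\frac1{K+1}$ return High; else return the value $\hat\mu/(1-\hat\mu)$. **Estimate-Neighborhood**$(x,\kappa,\beta,\eta,\delta)$. Let $\theta=\kappa\eta\beta\delta/64$. Choose an integer $i$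 uniformly with $0\le i<\kappa/\theta$ and let $\alpha=\kappa+i\theta$. Draw a sample $S$ of $\Theta(\log(1/\delta)/(\beta\eta^2))$ points by SAMP. Call Compare$(x,y,\theta/4,4,\delta/(4|S|))$ once for each distinct point $y$ of $S$. Return $(\hat w,\alpha)$, where $\hat w$ is the fraction of occurrences in $S$ of points $y$ for which a value in $[\frac1{1+\alpha+\theta/2},\,1+\alpha+\theta/2]$ was returned. **Find-Reference**$(\kappa)$. Draw a sample $X$ of $\Theta(\log(1/\kappa)/\kappa^2)$ points by SAMP. For each $x\in X$: 1. Call Estimate-Neighborhood with $x$, $\kappa$, $\beta=\kappa^2/(40\log(1/\kappa))$, $\eta=\kappa$, $\delta=1/(40|X|)$, obtaining $(\hat w(x),\alpha)$; let $\theta=\kappa\eta\beta\delta/64$. If $\hat w(x)<\kappa^2/(20\log(1/\kappa))$, reject $x$ and go on with the next $x$. 2. Choose $Y_x$ consisting of $\Theta(\log^2(1/\kappa)/\kappa^5)$ uniform points of $[N]$, and call Compare$(x,y,\theta/4,4,1/(40|X||Y_x|))$ for each $y\in Y_x$. Let $\hat\mu(x)$ be the fraction of $y\in Y_x$ for which a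 value in $[\frac1{1+\alpha+\theta/2},\,1+\alpha+\theta/2]$ was returned, and let $\widehat D(x)=\hat w(x)/(\hat\mu(x)N)$. 3. Accept $x$ if $\hat\mu(x)\ge\kappa^3/(20\log(1/\kappa))$ and $\frac{\kappa}{4N}\le\widehat D(x)\le\frac{2}{\kappa N}$. If some $x\in X$ is accepted, return $(x,\widehat D(x))$ for the first such $x$; otherwise return No-Pair. **Main algorithm**$(\varepsilon)$, $0<\varepsilon\le 1$. Call Find-Reference with $\kappa=\varepsilon/8$. If it returns No-Pair, output $\hat d=1$. Otherwise let $(x,\widehat D(x))$ be its output. Choose $S$ consisting of $\Theta(1/\varepsilon^2)$ uniform points of $[N]$ and let $K=\max\{\frac{2/N}{\widehat D(x)},\frac{\widehat D(x)}{\varepsilon/(4N)}\}$. For each $y\in S$ call Compare$(x,y,\varepsilon/2,K,\frac1{10|S|})$. If it returns High, or a value $\rho(y)$ with $\rho(y)\widehat D(x)\ge\frac1N$, set $\hat\psi(y)=0$; else if it returns Low, or a value with $\rho(y)\widehat D(x)\le\frac{\varepsilon}{4N}$, set $\hat\psi(y)=1$; else set $\hat\psi(y)=1-N\rho(y)\widehat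 D(x)$. Output $\hat d=\frac1{|S|}\sum_{y\in S}\hat\psi(y)$. **Theorem 7.2.** The absolute constants in the $\Theta(\cdot)$ can be chosen such that, for some absolute constants $C_1,C_2$ and $a\in\mathbb N$, for every $\varepsilon\in(0,1]$ and every $N\ge1$: * the main algorithm never makes more than $C_2\,\varepsilon^{-20}\log^a(2/\varepsilon)$ PCOND and SAMP queries in total, i.e. $\tilde O(1/\varepsilon^{20})$, independently of $N$; * for every distribution $D$ on $[N]$, with probability at least $2/3$ the algorithm does not fail and its output satisfies $|\hat d-d_{\rm TV}(D,\mathcal U)|\le C_1\varepsilon$. -/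

import Mathlib

noncomputable section

/-- An adaptive randomized algorithm over the domain `[N]` (written `Fin N`) with oracle access to an
unknown distribution, as a decision tree. A node is an output, a call to the sampling oracle, a call
to the pair-conditional oracle on a set `{i, j}` of size two, or an internal random choice that is
uniform on `m` values and costs no query. -/
inductive QueryAlg (N : ℕ) (α : Type) : Type
  | ret (a : α) : QueryAlg N α
  | samp (k : Fin N → QueryAlg N α) : QueryAlg N α
  | pcond (i j : Fin N) (hij : i ≠ j) (k : Fin N → QueryAlg N α) : QueryAlg N α
  | coin (m : ℕ) (hm : m ≠ 0) (k : Fin m → QueryAlg N α) : QueryAlg N α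

namespace QueryAlg

variable {N : ℕ} {α β : Type}

/-- Sequential composition. -/
def bind : QueryAlg N α → (α → QueryAlg N β) → QueryAlg N β
  | ret a, f => f a
  | samp k, f => samp fun i => (k i).bind f
  | pcond i j hij k, f => pcond i j hij fun l => (k l).bind f
  | coin m hm k, f => coin m hm fun l => (k l).bind f

instance : Monad (QueryAlg N) where
  pure := ret
  bind := bind

/-- The number of oracle calls (SAMP and PCOND together) on the worst execution path, over all
oracle answers and all internal random choices. -/
def queries : QueryAlg N α → ℕ
  | ret _ => 0
  | samp k => 1 + Finset.univ.sup fun i => (k i).queries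
  | pcond _ _ _ k => 1 + Finset.univ.sup fun l => (k l).queries
  | coin _ _ k => Finset.univ.sup fun l => (k l).queries

open Classical in
/-- The distribution of the outcome when the oracles answer according to `D`, with fresh
independent randomness at each call. A PCOND call on `{i, j}` returns a draw from `D` conditioned on
`{i, j}`; if this set has probability zero, the algorithm fails and stops (outcome `none`). -/
def run (D : PMF (Fin N)) : QueryAlg N α → PMF (Option α)
  | ret a => PMF.pure (some a)
  | samp k => D.bind fun i => (k i).run D
  | pcond i j _ k =>
      if h : ∃ l ∈ ({i, j} : Set (Fin N)), l ∈ D.support then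
        (D.filter {i, j} h).bind fun l => (k l).run D
      else PMF.pure none
  | coin m hm k =>
      haveI : NeZero m := ⟨hm⟩
      (PMF.uniformOfFintype (Fin m)).bind fun l => (k l).run D

/-- The probability that the algorithm, run on `D`, does not fail and outputs an element of `S`. -/
def outputProb (A : QueryAlg N α) (D : PMF (Fin N)) (S : Set α) : ENNReal :=
  (A.run D).toOuterMeasure (some '' S)

/-- Run `A` independently `m` times and list the outputs. -/
def repeatAlg (A : QueryAlg N α) : ℕ → QueryAlg N (List α)
  | 0 => ret []
  | m + 1 => do
      let a ← A
      let l ← repeatAlg A m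
      return a :: l

/-- Run `f` on each entry of a list, one after the other. -/
def mapAlg (f : α → QueryAlg N β) : List α → QueryAlg N (List β)
  | [] => ret []
  | a :: l => do
      let b ← f a
      let l' ← mapAlg f l
      return b :: l'

/-- Run `f` on each entry of a list, one after the other, and keep those on which it returns
`true`. -/
def filterAlg (f : α → QueryAlg N Bool) : List α → QueryAlg N (List α)
  | [] => ret []
  | a :: l => do
      let b ← f a
      let l' ← filterAlg f l
      return if b then a :: l' else l'

/-- One call to the SAMP oracle. -/
def drawSamp : QueryAlg N (Fin N) := samp ret

/-- A point of `[N]` chosen uniformly at random by the algorithm (no query). -/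
def drawUniform [NeZero N] : QueryAlg N (Fin N) := coin N (NeZero.ne N) ret

/-- A uniformly random natural number `i < r` (for `r ≤ 0` the value is `0`). -/
def drawBelow (r : ℝ) : QueryAlg N ℕ :=
  if h : ⌈r⌉₊ = 0 then ret 0 else coin ⌈r⌉₊ h fun i => ret i

end QueryAlg

/-- Total variation distance, half the `ℓ¹` distance. -/
def tvDist {N : ℕ} (D₁ D₂ : PMF (Fin N)) : ℝ :=
  (1 / 2) * ∑ i, |(D₁ i).toReal - (D₂ i).toReal|

/-- The positive absolute constants hidden in the `Θ(·)` of the five sample sizes. -/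
structure ThetaConsts where
  /-- queries of one call of Compare -/
  cmp : ℝ
  /-- samples in Estimate-Neighborhood -/
  nbhd : ℝ
  /-- candidate reference points in Find-Reference -/
  cand : ℝ
  /-- uniform points per candidate in Find-Reference -/
  unif : ℝ
  /-- uniform points in the main algorithm -/
  main : ℝ
  cmp_pos : 0 < cmp
  nbhd_pos : 0 < nbhd
  cand_pos : 0 < cand
  unif_pos : 0 < unif
  main_pos : 0 < main

/-- The output of Compare: `Low`, `High`, or a value. -/
inductive CompareResult : Type
  | low : CompareResult
  | high : CompareResult
  | value (ρ : ℝ) : CompareResult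

/-- The output is a value in the interval `[a, b]`. -/
def CompareResult.InRange (a b : ℝ) : CompareResult → Prop
  | low => False
  | high => False
  | value ρ => a ≤ ρ ∧ ρ ≤ b

open QueryAlg

variable {N : ℕ}

/-- Compare on the singletons `{x}` and `{y}`: estimates `D(y) / D(x)` from PCOND queries on
`{x, y}`. When `y = x` the ratio is known to be `1` and is returned without a query. -/
def compareAlg (c : ThetaConsts) (x y : Fin N) (η K δ : ℝ) : QueryAlg N CompareResult :=
  if hxy : x ≠ y then do
    let answers ← repeatAlg (pcond x y hxy ret) ⌈c.cmp * (K * Real.log (1 / δ) / η ^ 2)⌉₊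
    let μ : ℝ := (answers.count y : ℝ) / answers.length
    if μ < (2 / 3) * (1 / (K + 1)) then return CompareResult.low
    else if 1 - μ < (2 / 3) * (1 / (K + 1)) then return CompareResult.high
    else return CompareResult.value (μ / (1 - μ))
  else return CompareResult.value 1

open Classical in
/-- The points `y` of a list for which Compare with `x` at accuracy `θ / 4`, `K = 4` and confidence
`δ` returns a value in `[1 / (1 + α + θ / 2), 1 + α + θ / 2]`. -/
def closePoints (c : ThetaConsts) (x : Fin N) (θ α δ : ℝ) (l : List (Fin N)) :
    QueryAlg N (List (Fin N)) :=
  filterAlg (fun y => do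
    let ρ ← compareAlg c x y (θ / 4) 4 δ
    return decide (ρ.InRange (1 / (1 + α + θ / 2)) (1 + α + θ / 2))) l

/-- The width `θ` used in Estimate-Neighborhood. -/
def thetaOf (κ β η δ : ℝ) : ℝ := κ * η * β * δ / 64

/-- Estimate-Neighborhood: returns a pair `(ŵ, α)` where `ŵ` estimates the weight of the points `y`
whose weight is within a factor `1 + α` of that of `x`. Compare is called once on each distinct
point of the sample, and `ŵ` counts occurrences with multiplicity. -/
def estimateNeighborhood (c : ThetaConsts) (x : Fin N) (κ β η δ : ℝ) : QueryAlg N (ℝ × ℝ) := do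
  let θ := thetaOf κ β η δ
  let i ← drawBelow (κ / θ)
  let α := κ + i * θ
  let S ← repeatAlg drawSamp ⌈c.nbhd * (Real.log (1 / δ) / (β * η ^ 2))⌉₊
  let T ← closePoints c x θ α (δ / (4 * S.length)) S.dedup
  return (((S.filter (· ∈ T)).length : ℝ) / S.length, α)

/-- The treatment of one candidate `x` in Find-Reference, when there are `s` candidates. Returns
`(x, D̂(x))` if `x` is acceptable as a reference point, and `none` otherwise. -/
def examineCandidate [NeZero N] (c : ThetaConsts) (κ : ℝ) (s : ℕ) (x : Fin N) :
    QueryAlg N (Option (Fin N × ℝ)) := do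
  let L := Real.log (1 / κ)
  let β := κ ^ 2 / (40 * L)
  let η := κ
  let δ := 1 / (40 * (s : ℝ))
  let θ := thetaOf κ β η δ
  let (w, α) ← estimateNeighborhood c x κ β η δ
  if w < κ ^ 2 / (20 * L) then return none
  else
    let Y ← repeatAlg drawUniform ⌈c.unif * (L ^ 2 / κ ^ 5)⌉₊
    let T ← closePoints c x θ α (1 / (40 * (s : ℝ) * Y.length)) Y
    let μ : ℝ := (T.length : ℝ) / Y.length
    let d : ℝ := w / (μ * N)
    if κ ^ 3 / (20 * L) ≤ μ ∧ κ / (4 * N) ≤ d ∧ d ≤ 2 / (κ * N) then return some (x, d)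
    else return none

/-- Find-Reference: returns a reference point with an estimate of its weight, or `none` (No-Pair).
All candidates are treated; the first acceptable one is returned. -/
def findReference [NeZero N] (c : ThetaConsts) (κ : ℝ) : QueryAlg N (Option (Fin N × ℝ)) := do
  let X ← repeatAlg drawSamp ⌈c.cand * (Real.log (1 / κ) / κ ^ 2)⌉₊
  let results ← mapAlg (examineCandidate c κ X.length) X
  return results.findSome? id

/-- The estimate `ψ̂(y)` computed from the output of Compare, where `d = D̂(x)`. -/
def psiHat (N : ℕ) (ε d : ℝ) : CompareResult → ℝ
  | CompareResult.high => 0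
  | CompareResult.low => 1
  | CompareResult.value ρ =>
      if 1 / N ≤ ρ * d then 0
      else if ρ * d ≤ ε / (4 * N) then 1
      else 1 - N * (ρ * d)

/-- The algorithm that estimates the distance to uniformity, with parameter `ε`. -/
def estimateDistUnif (c : ThetaConsts) (N : ℕ) [NeZero N] (ε : ℝ) : QueryAlg N ℝ := do
  let ref ← findReference c (ε / 8)
  match ref with
  | none => return 1
  | some (x, d) =>
    let S ← repeatAlg drawUniform ⌈c.main * (1 / ε ^ 2)⌉₊
    let K : ℝ := max ((2 / N) / d) (d / (ε / (4 * N)))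
    let ψ ← mapAlg (fun y => do
      let r ← compareAlg c x y (ε / 2) K (1 / (10 * (S.length : ℝ)))
      return psiHat N ε d r) S
    return (1 / (S.length : ℝ)) * ψ.sum

end

/-! The distance to uniformity is the mean of ψ(y) = max(0, 1 − N·D(y)) at a uniform point y
(`sum_max_zero_eq_tvDist_uniform`). Once the weight of a single reference point x is known up to a
factor 1 ± ε/2, Compare yields D(y)/D(x) and hence ψ(y) up to 5ε (`abs_psiHat_sub_le`); averaging
over Θ(1/ε²) uniform points costs another ε.

To estimate D(x), let W and U be the D-weight and the uniform weight of the points whose weight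
agrees with D(x) up to a factor 1 + α. Then W ≈ U·N·D(x), so D(x) ≈ W/(U·N), and both W and U can be
sampled, with Compare deciding membership. Compare is unreliable only on the annulus between α and α
+ θ. The random choice of α makes this annulus light under D (`guarantee_drawBelow_increment`), and
`closeWeight_sub_le` carries this over to the uniform distribution. The observed frequencies are
thus squeezed between two accurate ones (`abs_sub_le_of_between`).

A usable reference point exists unless the distance is close to 1. Indeed ∑ min(D(i), 1/N) = 1 −
d_TV. Very light and very heavy points contribute little to this sum. The moderate points fall into
O(log(1/κ)/κ) geometric buckets, each contained in the neighbourhood of any of its members, so those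
with a light neighbourhood carry little weight (`sum_light_le`). Hence, if 1 − d_TV ≥ 4κ, good
references have weight at least κ and the candidates contain one with high probability; otherwise
the output 1 is within 4κ = ε/2 of the truth.

Failure probabilities are combined by union bounds on `Guarantee`; the concentration input is the
Chernoff bound `HasLaw.guarantee_abs_sub_le`. The query bound multiplies worst-case counts in the
calculus of `PolyBound`. -/

open QueryAlg

/-! ### Real-valued semantics of query algorithms, union bounds and query counts. -/

namespace QueryAlg

variable {N : ℕ} {α β : Type}

/-- The probability of the answer `l` of a PCOND call on `{i, j}`; all values are `0` when the call
fails. -/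
noncomputable def condProb (D : PMF (Fin N)) (i j l : Fin N) : ℝ :=
  if l = i ∨ l = j then (D l).toReal / ((D i).toReal + (D j).toReal) else 0

/-- The expected value of `f` at the output of an algorithm, where a failing run counts `0`. -/
noncomputable def expect (D : PMF (Fin N)) : QueryAlg N α → (α → ℝ) → ℝ
  | ret a, f => f a
  | samp k, f => ∑ i, (D i).toReal * (k i).expect D f
  | pcond i j _ k, f => ∑ l, condProb D i j l * (k l).expect D f
  | coin m _ k, f => ∑ l, (1 / (m : ℝ)) * (k l).expect D f

/-- The property `P` holds at the output of every execution path. -/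
def Always (P : α → Prop) : QueryAlg N α → Prop
  | ret a => P a
  | samp k => ∀ i, (k i).Always P
  | pcond _ _ _ k => ∀ i, (k i).Always P
  | coin _ _ k => ∀ i, (k i).Always P

open Classical in
/-- Except with probability `δ` the algorithm does not fail and its output satisfies `Q`. -/
def Guarantee (D : PMF (Fin N)) (A : QueryAlg N α) (Q : α → Prop) (δ : ℝ) : Prop :=
  1 - δ ≤ A.expect D fun a => if Q a then 1 else 0

lemma condProb_nonneg (D : PMF (Fin N)) (i j l : Fin N) : 0 ≤ condProb D i j l := by
  unfold condProb
  split_ifs <;> positivity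

lemma sum_toReal (D : PMF (Fin N)) : ∑ i, (D i).toReal = 1 := by
  rw [← ENNReal.toReal_sum fun i _ => D.apply_ne_top i, ← tsum_fintype (L := .unconditional _),
    D.tsum_coe, ENNReal.toReal_one]

lemma sum_condProb_mul (D : PMF (Fin N)) {i j : Fin N} (hij : i ≠ j) (f : Fin N → ℝ) :
    ∑ l, condProb D i j l * f l =
      ((D i).toReal * f i + (D j).toReal * f j) / ((D i).toReal + (D j).toReal) := by
  rw [← Finset.sum_subset (Finset.subset_univ {i, j}), Finset.sum_pair hij]
  · simp only [condProb, true_or, or_true, if_true]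
    ring
  · intro l _ hl
    simp only [Finset.mem_insert, Finset.mem_singleton] at hl
    simp [condProb, hl]

lemma sum_condProb_le_one (D : PMF (Fin N)) {i j : Fin N} (hij : i ≠ j) :
    ∑ l, condProb D i j l ≤ 1 := by
  have h := sum_condProb_mul D hij fun _ => 1
  simp only [mul_one] at h
  rw [h]
  exact div_self_le_one _

@[simp] lemma expect_pure (D : PMF (Fin N)) (a : α) (f : α → ℝ) :
    (pure a : QueryAlg N α).expect D f = f a := rfl

@[simp] lemma expect_ret (D : PMF (Fin N)) (a : α) (f : α → ℝ) :
    (ret a : QueryAlg N α).expect D f = f a := rfl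

@[simp] lemma expect_bind (D : PMF (Fin N)) (A : QueryAlg N α) (g : α → QueryAlg N β)
    (f : β → ℝ) : (A >>= g).expect D f = A.expect D fun a => (g a).expect D f := by
  change (A.bind g).expect D f = _
  induction A with
  | ret a => rfl
  | samp k ih => simp only [bind, expect, ih]
  | pcond i j hij k ih => simp only [bind, expect, ih]
  | coin m hm k ih => simp only [bind, expect, ih]

lemma expect_add (D : PMF (Fin N)) (A : QueryAlg N α) (f g : α → ℝ) :
    A.expect D (fun a => f a + g a) = A.expect D f + A.expect D g := by
  induction A with
  | ret a => rfl
  | samp k ih => simp only [expect, ih, mul_add, Finset.sum_add_distrib]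
  | pcond i j hij k ih => simp only [expect, ih, mul_add, Finset.sum_add_distrib]
  | coin m hm k ih => simp only [expect, ih, mul_add, Finset.sum_add_distrib]

lemma expect_const_mul (D : PMF (Fin N)) (A : QueryAlg N α) (c : ℝ) (f : α → ℝ) :
    A.expect D (fun a => c * f a) = c * A.expect D f := by
  induction A with
  | ret a => rfl
  | samp k ih => simp only [expect, ih, mul_left_comm _ c, Finset.mul_sum]
  | pcond i j hij k ih => simp only [expect, ih, mul_left_comm _ c, Finset.mul_sum]
  | coin m hm k ih => simp only [expect, ih, mul_left_comm _ c, Finset.mul_sum]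

lemma expect_mono_of_always (D : PMF (Fin N)) {A : QueryAlg N α} {P : α → Prop} (hA : A.Always P)
    {f g : α → ℝ} (h : ∀ a, P a → f a ≤ g a) : A.expect D f ≤ A.expect D g := by
  induction A with
  | ret a => exact h a hA
  | samp k ih =>
    exact Finset.sum_le_sum fun i _ => mul_le_mul_of_nonneg_left (ih i (hA i)) (by positivity)
  | pcond i j hij k ih =>
    exact Finset.sum_le_sum fun l _ =>
      mul_le_mul_of_nonneg_left (ih l (hA l)) (condProb_nonneg _ _ _ _)
  | coin m hm k ih =>
    exact Finset.sum_le_sum fun l _ => mul_le_mul_of_nonneg_left (ih l (hA l)) (by positivity)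

lemma always_of_forall {P : α → Prop} (h : ∀ a, P a) (A : QueryAlg N α) : A.Always P := by
  induction A with
  | ret a => exact h a
  | samp k ih => exact ih
  | pcond i j hij k ih => exact ih
  | coin m hm k ih => exact ih

lemma expect_mono (D : PMF (Fin N)) (A : QueryAlg N α) {f g : α → ℝ} (h : ∀ a, f a ≤ g a) :
    A.expect D f ≤ A.expect D g :=
  expect_mono_of_always D (always_of_forall (fun _ => trivial) A) fun a _ => h a

lemma expect_one_le (D : PMF (Fin N)) (A : QueryAlg N α) : A.expect D (fun _ => 1) ≤ 1 := by
  induction A with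
  | ret a => exact le_rfl
  | samp k ih =>
    calc _ ≤ ∑ i, (D i).toReal * 1 :=
          Finset.sum_le_sum fun i _ => mul_le_mul_of_nonneg_left (ih i) (by positivity)
      _ = 1 := by simp [sum_toReal]
  | pcond i j hij k ih =>
    calc _ ≤ ∑ l, condProb D i j l * 1 :=
          Finset.sum_le_sum fun l _ => mul_le_mul_of_nonneg_left (ih l) (condProb_nonneg _ _ _ _)
      _ ≤ 1 := by simpa using sum_condProb_le_one D hij
  | coin m hm k ih =>
    calc _ ≤ ∑ l : Fin m, (1 / (m : ℝ)) * 1 :=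
          Finset.sum_le_sum fun l _ => mul_le_mul_of_nonneg_left (ih l) (by positivity)
      _ = 1 := by
          have : (m : ℝ) ≠ 0 := by exact_mod_cast hm
          simp [this]

lemma Always.bind {P : α → Prop} {Q : β → Prop} {A : QueryAlg N α} {g : α → QueryAlg N β}
    (hA : A.Always P) (hg : ∀ a, P a → (g a).Always Q) : (A >>= g).Always Q := by
  change (A.bind g).Always Q
  induction A with
  | ret a => exact hg a hA
  | samp k ih => exact fun i => ih i (hA i)
  | pcond i j hij k ih => exact fun i => ih i (hA i)
  | coin m hm k ih => exact fun i => ih i (hA i)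

lemma always_repeatAlg (A : QueryAlg N α) (n : ℕ) :
    (repeatAlg A n).Always fun l => l.length = n := by
  induction n with
  | zero => exact rfl
  | succ n ih =>
    refine Always.bind (always_of_forall (fun _ => trivial) A) fun a _ => ih.bind fun l hl => ?_
    change (a :: l).length = n + 1
    simp [hl]

/-- The continuation is bounded only on outputs that some path attains. This matters because later
costs depend on the length of earlier samples, which `always_repeatAlg` fixes on every path. -/
lemma queries_bind_le {P : α → Prop} {A : QueryAlg N α} {g : α → QueryAlg N β} {b : ℕ}
    (hA : A.Always P) (hg : ∀ a, P a → (g a).queries ≤ b) :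
    (A >>= g).queries ≤ A.queries + b := by
  change (A.bind g).queries ≤ _
  induction A with
  | ret a => simpa [bind, queries] using hg a hA
  | samp k ih =>
    simp only [bind, queries, add_assoc]
    refine Nat.add_le_add_left (Finset.sup_le fun i hi => (ih i (hA i)).trans ?_) 1
    exact Nat.add_le_add_right (Finset.le_sup (f := fun i => (k i).queries) hi) b
  | pcond i j hij k ih =>
    simp only [bind, queries, add_assoc]
    refine Nat.add_le_add_left (Finset.sup_le fun i hi => (ih i (hA i)).trans ?_) 1
    exact Nat.add_le_add_right (Finset.le_sup (f := fun i => (k i).queries) hi) b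
  | coin m hm k ih =>
    simp only [bind, queries]
    refine Finset.sup_le fun i hi => (ih i (hA i)).trans ?_
    exact Nat.add_le_add_right (Finset.le_sup (f := fun i => (k i).queries) hi) b

lemma queries_bind_le' {A : QueryAlg N α} {g : α → QueryAlg N β} {b : ℕ}
    (hg : ∀ a, (g a).queries ≤ b) : (A >>= g).queries ≤ A.queries + b :=
  queries_bind_le (always_of_forall (fun _ => trivial) A) fun a _ => hg a

lemma queries_repeatAlg_le (A : QueryAlg N α) (n : ℕ) :
    (repeatAlg A n).queries ≤ n * A.queries := by
  induction n with
  | zero => exact Nat.zero_le _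
  | succ n ih =>
    refine (queries_bind_le' (b := n * A.queries) fun a => ?_).trans_eq (by ring)
    exact (queries_bind_le' (b := 0) fun l => le_rfl).trans ih

lemma queries_mapAlg_le {f : α → QueryAlg N β} {b : ℕ} (hf : ∀ a, (f a).queries ≤ b)
    (l : List α) : (mapAlg f l).queries ≤ l.length * b := by
  induction l with
  | nil => exact Nat.zero_le _
  | cons a l ih =>
    refine (queries_bind_le' (b := l.length * b) fun a => ?_).trans ?_
    · exact (queries_bind_le' (b := 0) fun l => le_rfl).trans ih
    · have := hf a
      rw [List.length_cons, add_mul, one_mul]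
      omega

lemma queries_filterAlg_le {f : α → QueryAlg N Bool} {b : ℕ} (hf : ∀ a, (f a).queries ≤ b)
    (l : List α) : (filterAlg f l).queries ≤ l.length * b := by
  induction l with
  | nil => exact Nat.zero_le _
  | cons a l ih =>
    refine (queries_bind_le' (b := l.length * b) fun a => ?_).trans ?_
    · exact (queries_bind_le' (b := 0) fun l => le_rfl).trans ih
    · have := hf a
      rw [List.length_cons, add_mul, one_mul]
      omega

lemma Guarantee.nonneg {D : PMF (Fin N)} {A : QueryAlg N α} {Q : α → Prop} {δ : ℝ}
    (h : Guarantee D A Q δ) : 0 ≤ δ := by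
  classical
  have h1 : (A.expect D fun a => if Q a then 1 else 0) ≤ A.expect D fun _ => 1 :=
    expect_mono D A fun a => by split_ifs <;> norm_num
  have := expect_one_le D A
  unfold Guarantee at h
  linarith

lemma Guarantee.mono_of_always {D : PMF (Fin N)} {A : QueryAlg N α} {P Q R : α → Prop} {δ δ' : ℝ}
    (h : Guarantee D A Q δ) (hA : A.Always P) (hR : ∀ a, P a → Q a → R a) (hδ : δ ≤ δ') :
    Guarantee D A R δ' := by
  classical
  have h1 : (A.expect D fun a => if Q a then 1 else 0) ≤ A.expect D fun a => if R a then 1 else 0 :=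
    expect_mono_of_always D hA fun a ha => by
      have := hR a ha
      split_ifs <;> simp_all
  unfold Guarantee at h ⊢
  linarith

lemma Guarantee.mono {D : PMF (Fin N)} {A : QueryAlg N α} {Q R : α → Prop} {δ δ' : ℝ}
    (h : Guarantee D A Q δ) (hR : ∀ a, Q a → R a) (hδ : δ ≤ δ') : Guarantee D A R δ' :=
  h.mono_of_always (always_of_forall (fun _ => trivial) A) (fun a _ => hR a) hδ

lemma guarantee_pure (D : PMF (Fin N)) {Q : α → Prop} {a : α} (h : Q a) :
    Guarantee D (pure a) Q 0 := by
  simp [Guarantee, h]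

lemma Guarantee.bind {D : PMF (Fin N)} {A : QueryAlg N α} {g : α → QueryAlg N β} {P : α → Prop}
    {Q : β → Prop} {δ₁ δ₂ : ℝ} (hA : Guarantee D A P δ₁)
    (hg : ∀ a, P a → Guarantee D (g a) Q δ₂) (hδ : 0 ≤ δ₂) :
    Guarantee D (A >>= g) Q (δ₁ + δ₂) := by
  classical
  have h0 : ∀ a, 0 ≤ (g a).expect D fun b => if Q b then (1 : ℝ) else 0 := fun a => by
    have := expect_mono D (g a) (f := fun _ => 0 * 1) (g := fun b => if Q b then (1 : ℝ) else 0)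
      fun b => by split_ifs <;> norm_num
    rw [expect_const_mul] at this
    simpa using this
  have hle := expect_mono D A
    (f := fun a => (1 - δ₂) * if P a then 1 else 0)
    (g := fun a => (g a).expect D fun b => if Q b then 1 else 0)
    fun a => by
      by_cases ha : P a
      · have hga := hg a ha
        unfold Guarantee at hga
        simpa only [ha, if_true, mul_one] using hga
      · simpa [ha] using h0 a
  rw [expect_const_mul] at hle
  have h1 : (A.expect D fun a => if P a then 1 else 0) ≤ A.expect D fun _ => 1 :=
    expect_mono D A fun a => by split_ifs <;> norm_num
  have h2 := expect_one_le D A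
  unfold Guarantee at hA ⊢
  rw [expect_bind]
  -- With p the probability of `P`, the bound is (1 − δ₂)p = p − δ₂p ≥ 1 − δ₁ − δ₂. Only p ≤ 1 and
  -- δ₂ ≥ 0 enter, so the sign of 1 − δ₂ is irrelevant.
  nlinarith [hA, hδ]

lemma Guarantee.and {D : PMF (Fin N)} {A : QueryAlg N α} {P Q : α → Prop} {δ₁ δ₂ : ℝ}
    (hP : Guarantee D A P δ₁) (hQ : Guarantee D A Q δ₂) :
    Guarantee D A (fun a => P a ∧ Q a) (δ₁ + δ₂) := by
  classical
  have h := expect_mono D A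
    (f := fun a => (if P a then 1 else 0) + if Q a then 1 else 0)
    (g := fun a => (@ite _ (P a ∧ Q a) (Classical.propDecidable _) 1 0) + 1) fun a => by
      by_cases h1 : P a <;> by_cases h2 : Q a <;> simp [h1, h2]
  rw [expect_add, expect_add] at h
  have h2 := expect_one_le D A
  unfold Guarantee at hP hQ ⊢
  linarith

lemma guarantee_mapAlg {D : PMF (Fin N)} {f : α → QueryAlg N β} {R : α → β → Prop} {δ : ℝ}
    (hδ : 0 ≤ δ) {l : List α} (h : ∀ a ∈ l, Guarantee D (f a) (R a) δ) :
    Guarantee D (mapAlg f l) (List.Forall₂ R l) (l.length * δ) := by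
  induction l with
  | nil =>
    exact (guarantee_pure D (List.Forall₂.nil (R := R))).mono (fun _ h => h) (by simp)
  | cons a l ih =>
    have h1 := h a (by simp)
    have h2 := ih fun b hb => h b (by simp [hb])
    refine (h1.bind (δ₂ := l.length * δ + 0) (fun b hb => h2.bind (fun l' hl' => ?_) le_rfl)
      (by positivity)).mono (fun _ h => h) (le_of_eq ?_)
    · exact guarantee_pure D (List.Forall₂.cons hb hl')
    · push_cast [List.length_cons]
      ring

-- The test is controlled only outside a gap: it must accept on `P` and reject outside `Q`, and
-- between the two its answer is arbitrary. The kept list can therefore only be sandwiched.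
open Classical in
lemma guarantee_filterAlg {D : PMF (Fin N)} {f : α → QueryAlg N Bool} {P Q : α → Prop} {δ : ℝ}
    (hδ : 0 ≤ δ) {l : List α}
    (h : ∀ a ∈ l, Guarantee D (f a) (fun b => (P a → b = true) ∧ (b = true → Q a)) δ) :
    Guarantee D (filterAlg f l)
      (fun T => (l.filter (P ·)).Sublist T ∧ T.Sublist (l.filter (Q ·))) (l.length * δ) := by
  induction l with
  | nil =>
    refine (guarantee_pure D (a := ([] : List α)) (Q := fun T => T = []) rfl).mono (fun T h => ?_)
      (by simp)
    simp [h]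
  | cons a l ih =>
    have h1 := h a (by simp)
    have h2 := ih fun b hb => h b (by simp [hb])
    refine (h1.bind (δ₂ := l.length * δ + 0) (fun b hb => h2.bind (fun l' hl' => ?_) le_rfl)
      (by positivity)).mono (fun _ h => h) (le_of_eq ?_)
    · refine guarantee_pure D ?_
      obtain ⟨hP, hQ⟩ := hb
      cases b
      · have hPa : ¬ P a := fun hp => by simpa using hP hp
        simp only [List.filter_cons, hPa, decide_false, Bool.false_eq_true, if_false]
        refine ⟨hl'.1, hl'.2.trans ?_⟩
        split_ifs
        · exact List.sublist_cons_self _ _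
        · exact List.Sublist.refl _
      · have hQa : Q a := hQ rfl
        simp only [List.filter_cons, hQa, decide_true, if_true]
        refine ⟨?_, hl'.2.cons_cons a⟩
        split_ifs
        · exact hl'.1.cons_cons a
        · exact hl'.1.cons a
    · push_cast [List.length_cons]
      ring

lemma filter_pair_apply (D : PMF (Fin N)) {i j : Fin N} (hij : i ≠ j)
    (h : ∃ l ∈ ({i, j} : Set (Fin N)), l ∈ D.support) (l : Fin N) :
    D.filter {i, j} h l = ENNReal.ofReal (condProb D i j l) := by
  have hs : ∑' a, ({i, j} : Set (Fin N)).indicator D a = D i + D j := by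
    rw [tsum_fintype, ← Finset.sum_subset (Finset.subset_univ {i, j}), Finset.sum_pair hij]
    · simp
    · intro l _ hl
      simp only [Finset.mem_insert, Finset.mem_singleton] at hl
      simp [hl]
  have hpos : D i + D j ≠ 0 := by
    obtain ⟨l, hl, hl'⟩ := h
    rw [PMF.mem_support_iff] at hl'
    rcases hl with rfl | rfl <;> simp [hl']
  have htop : D i + D j ≠ ⊤ := ENNReal.add_ne_top.2 ⟨D.apply_ne_top i, D.apply_ne_top j⟩
  rw [PMF.filter_apply, hs, condProb]
  split_ifs with hl
  · rw [← ENNReal.toReal_add (D.apply_ne_top i) (D.apply_ne_top j), ← ENNReal.toReal_div,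
      ENNReal.ofReal_toReal (ENNReal.div_ne_top (D.apply_ne_top l) hpos), div_eq_mul_inv,
      Set.indicator_of_mem (by simpa using hl)]
  · rw [Set.indicator_of_notMem (by simpa using hl)]
    simp

-- The bridge from `expect` to the PMF semantics. One inequality suffices, so subadditivity of
-- `ENNReal.ofReal` avoids any sign condition on the expectations.
open Classical in
lemma ofReal_expect_le_outputProb (D : PMF (Fin N)) (A : QueryAlg N α) (S : Set α) :
    ENNReal.ofReal (A.expect D fun a => if a ∈ S then 1 else 0) ≤ A.outputProb D S := by
  have key : ∀ {ι : Type} [Fintype ι] (w : ι → ℝ) (e : ι → ℝ), (∀ i, 0 ≤ w i) →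
      ENNReal.ofReal (∑ i, w i * e i) ≤ ∑ i, ENNReal.ofReal (w i) * ENNReal.ofReal (e i) := by
    intro ι _ w e hw
    refine (Finset.le_sum_of_subadditive ENNReal.ofReal ENNReal.ofReal_zero.le
      (fun _ _ => ENNReal.ofReal_add_le) _ _).trans (Finset.sum_le_sum fun i _ => ?_)
    rw [ENNReal.ofReal_mul (hw i)]
  unfold outputProb
  induction A with
  | ret a =>
    simp only [expect, run, PMF.toOuterMeasure_pure_apply]
    split_ifs <;> simp_all
  | samp k ih =>
    simp only [expect, run, PMF.toOuterMeasure_bind_apply, tsum_fintype]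
    refine (key _ _ fun i => by positivity).trans (Finset.sum_le_sum fun i _ => ?_)
    rw [ENNReal.ofReal_toReal (D.apply_ne_top i)]
    exact mul_le_mul_right (ih i) _
  | pcond i j hij k ih =>
    simp only [expect, run]
    split_ifs with h
    · simp only [PMF.toOuterMeasure_bind_apply, tsum_fintype]
      refine (key _ _ fun l => condProb_nonneg _ _ _ _).trans (Finset.sum_le_sum fun l _ => ?_)
      rw [filter_pair_apply D hij h]
      exact mul_le_mul_right (ih l) _
    -- In a failing call both points have weight zero, so every `condProb` vanishes and the left
    -- side is 0.
    · have h0 : ∀ l, condProb D i j l = 0 := fun l => by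
        unfold condProb
        split_ifs with hl
        · have : D l = 0 := by
            by_contra hne
            exact h ⟨l, hl, (D.mem_support_iff l).2 hne⟩
          simp [this]
        · rfl
      simp [h0]
  | coin m hm k ih =>
    have : NeZero m := ⟨hm⟩
    simp only [expect, run, PMF.toOuterMeasure_bind_apply, tsum_fintype]
    refine (key _ _ fun l => by positivity).trans (Finset.sum_le_sum fun l _ => ?_)
    have : ENNReal.ofReal (1 / (m : ℝ)) = PMF.uniformOfFintype (Fin m) l := by
      rw [PMF.uniformOfFintype_apply, one_div, ENNReal.ofReal_inv_of_pos (by positivity)]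
      simp
    rw [this]
    exact mul_le_mul_right (ih l) _

lemma Guarantee.le_outputProb {D : PMF (Fin N)} {A : QueryAlg N α} {Q : α → Prop} {δ : ℝ}
    (h : Guarantee D A Q δ) : ENNReal.ofReal (1 - δ) ≤ A.outputProb D {a | Q a} :=
  (ENNReal.ofReal_le_ofReal h).trans (ofReal_expect_le_outputProb D A {a | Q a})

/-! ### Concentration of empirical means. -/

/-- The algorithm never fails, and its output has distribution `p`. -/
structure HasLaw (D : PMF (Fin N)) (A : QueryAlg N (Fin N)) (p : Fin N → ℝ) : Prop where
  nonneg : ∀ i, 0 ≤ p i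
  sum_eq_one : ∑ i, p i = 1
  expect_eq : ∀ g : Fin N → ℝ, A.expect D g = ∑ i, p i * g i

lemma hasLaw_drawSamp (D : PMF (Fin N)) : HasLaw D drawSamp fun i => (D i).toReal :=
  ⟨fun _ => ENNReal.toReal_nonneg, sum_toReal D, fun _ => rfl⟩

lemma hasLaw_drawUniform [NeZero N] (D : PMF (Fin N)) : HasLaw D drawUniform fun _ => 1 / (N : ℝ) := by
  have : (N : ℝ) ≠ 0 := by exact_mod_cast NeZero.ne N
  exact ⟨fun _ => by positivity, by simp [this], fun _ => rfl⟩

lemma hasLaw_pcond {D : PMF (Fin N)} {i j : Fin N} (hij : i ≠ j) (hi : 0 < (D i).toReal) :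
    HasLaw D (pcond i j hij ret) (condProb D i j) := by
  refine ⟨condProb_nonneg D i j, ?_, fun _ => rfl⟩
  have h := sum_condProb_mul D hij fun _ => 1
  simp only [mul_one] at h
  rw [h]
  have : 0 ≤ (D j).toReal := ENNReal.toReal_nonneg
  exact div_self (by positivity)

/-- Independence of the repeated runs, in the form that the Chernoff bound needs. -/
lemma expect_prod_repeatAlg (D : PMF (Fin N)) (A : QueryAlg N α) (g : α → ℝ) (n : ℕ) :
    (repeatAlg A n).expect D (fun l => (l.map g).prod) = A.expect D g ^ n := by
  induction n with
  | zero => simp [repeatAlg]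
  | succ n ih =>
    simp only [repeatAlg, expect_bind, expect_pure, List.map_cons, List.prod_cons,
      expect_const_mul, ih]
    simp only [mul_comm _ (A.expect D g ^ n), expect_const_mul]
    ring

lemma exp_le_one_add_add_sq {x : ℝ} (hx : |x| ≤ 1) : Real.exp x ≤ 1 + x + x ^ 2 := by
  have := Real.abs_exp_sub_one_sub_id_le hx
  linarith [(abs_le.1 this).2]

/-- Apply exp u ≤ 1 + u + u² to u = s(f − m). Since f² ≤ f on [0, 1], the variance is at most m − m²
≤ q, which makes the exponent proportional to q. -/
lemma HasLaw.expect_exp_le {D : PMF (Fin N)} {A : QueryAlg N (Fin N)} {p : Fin N → ℝ}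
    (hA : HasLaw D A p) {f : Fin N → ℝ} (hf0 : ∀ i, 0 ≤ f i) (hf1 : ∀ i, f i ≤ 1) {m q s : ℝ}
    (hm : ∑ i, p i * f i = m) (hq : m ≤ q) (hs : |s| ≤ 1) :
    A.expect D (fun i => Real.exp (s * (f i - m))) ≤ Real.exp (s ^ 2 * q) := by
  have hm0 : 0 ≤ m := hm ▸ Finset.sum_nonneg fun i _ => mul_nonneg (hA.nonneg i) (hf0 i)
  have hm1 : m ≤ 1 := by
    rw [← hm, ← hA.sum_eq_one]
    exact Finset.sum_le_sum fun i _ => mul_le_of_le_one_right (hA.nonneg i) (hf1 i)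
  rw [hA.expect_eq]
  have hsum : ∑ i, p i * (1 + s * (f i - m) + s ^ 2 * (f i - 2 * m * f i + m ^ 2)) =
      1 + s ^ 2 * (m - m ^ 2) := by
    have : ∀ i, p i * (1 + s * (f i - m) + s ^ 2 * (f i - 2 * m * f i + m ^ 2)) =
        p i * (1 - s * m + s ^ 2 * m ^ 2) + p i * f i * (s + s ^ 2 - 2 * m * s ^ 2) := fun i => by
      ring
    simp only [this, Finset.sum_add_distrib, ← Finset.sum_mul, hA.sum_eq_one, hm]
    ring
  calc _ ≤ ∑ i, p i * (1 + s * (f i - m) + s ^ 2 * (f i - 2 * m * f i + m ^ 2)) := by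
        refine Finset.sum_le_sum fun i _ => mul_le_mul_of_nonneg_left ?_ (hA.nonneg i)
        have h1 : |f i - m| ≤ 1 := abs_le.2 ⟨by linarith [hf0 i], by linarith [hf1 i]⟩
        have h2 : |s * (f i - m)| ≤ 1 := by
          rw [abs_mul]
          exact mul_le_one₀ hs (abs_nonneg _) h1
        refine (exp_le_one_add_add_sq h2).trans ?_
        have h3 : (f i - m) ^ 2 ≤ f i - 2 * m * f i + m ^ 2 := by
          nlinarith [hf0 i, hf1 i]
        nlinarith [mul_le_mul_of_nonneg_left h3 (sq_nonneg s)]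
    _ = 1 + s ^ 2 * (m - m ^ 2) := hsum
    _ ≤ s ^ 2 * q + 1 := by nlinarith [sq_nonneg s, sq_nonneg (s * m)]
    _ ≤ _ := Real.add_one_le_exp _

lemma expect_one_repeatAlg {D : PMF (Fin N)} {A : QueryAlg N α} (hA : A.expect D (fun _ => 1) = 1)
    (n : ℕ) : (repeatAlg A n).expect D (fun _ => 1) = 1 := by
  simpa [hA] using expect_prod_repeatAlg D A (fun _ => 1) n

lemma HasLaw.expect_one {D : PMF (Fin N)} {A : QueryAlg N (Fin N)} {p : Fin N → ℝ}
    (hA : HasLaw D A p) : A.expect D (fun _ => 1) = 1 := by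
  simp [hA.expect_eq, hA.sum_eq_one]

/-- A multiplicative Chernoff bound with an arbitrary upper bound `q` of the mean. -/
theorem HasLaw.guarantee_abs_sub_le {D : PMF (Fin N)} {A : QueryAlg N (Fin N)} {p : Fin N → ℝ}
    (hA : HasLaw D A p) {f : Fin N → ℝ} (hf0 : ∀ i, 0 ≤ f i) (hf1 : ∀ i, f i ≤ 1) {m q η : ℝ}
    (hm : ∑ i, p i * f i = m) (hq : m ≤ q) (hη0 : 0 < η) (hη : η ≤ 2) (n : ℕ) :
    Guarantee D (repeatAlg A n) (fun l => |(l.map f).sum - n * m| ≤ n * (η * q))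
      (2 * Real.exp (-(n * (η ^ 2 * q) / 4))) := by
  classical
  have hlist : ∀ (s : ℝ) (l : List (Fin N)),
      (l.map fun i => Real.exp (s * (f i - m))).prod =
        Real.exp (s * ((l.map f).sum - l.length * m)) := fun s l => by
    induction l with
    | nil => simp
    | cons a l ih =>
      rw [List.map_cons, List.prod_cons, ih, ← Real.exp_add]
      simp only [List.map_cons, List.sum_cons, List.length_cons]
      push_cast
      ring_nf
  have hmgf : ∀ s : ℝ, |s| ≤ 1 → (repeatAlg A n).expect D
      (fun l => (l.map fun i => Real.exp (s * (f i - m))).prod) ≤ Real.exp (n * (s ^ 2 * q)) :=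
    fun s hs => by
      rw [expect_prod_repeatAlg, Real.exp_nat_mul]
      refine pow_le_pow_left₀ ?_ (hA.expect_exp_le hf0 hf1 hm hq hs) n
      rw [hA.expect_eq]
      exact Finset.sum_nonneg fun i _ => mul_nonneg (hA.nonneg i) (Real.exp_pos _).le
  have hs1 : |η / 2| ≤ 1 := abs_le.2 ⟨by linarith, by linarith⟩
  have hs2 : |-(η / 2)| ≤ 1 := by rwa [abs_neg]
  have h1 := hmgf _ hs1
  have h2 := hmgf _ hs2
  -- Exponential Markov inequality for both tails with s = ±η/2: the exponent is n(η/2)²q −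
  -- (η/2)·nηq = −nη²q/4.
  set t : ℝ := Real.exp (-(η / 2 * (n * (η * q)))) with ht
  have key := expect_mono_of_always D (always_repeatAlg A n)
    (f := fun _ => 1)
    (g := fun l => (if |(l.map f).sum - n * m| ≤ n * (η * q) then 1 else 0) +
      (t * (l.map fun i => Real.exp (η / 2 * (f i - m))).prod +
       t * (l.map fun i => Real.exp (-(η / 2) * (f i - m))).prod)) fun l hl => by
      rw [hlist, hlist, hl, ht, ← Real.exp_add, ← Real.exp_add]
      split_ifs with hc
      · have := (Real.exp_pos (-(η / 2 * (n * (η * q))) + η / 2 * ((l.map f).sum - n * m))).le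
        have := (Real.exp_pos (-(η / 2 * (n * (η * q))) + -(η / 2) * ((l.map f).sum - n * m))).le
        linarith
      · rw [zero_add]
        rcases lt_abs.1 (not_le.1 hc) with h | h
        · refine (Real.one_le_exp ?_).trans (le_add_of_nonneg_right (Real.exp_pos _).le)
          nlinarith
        · refine (Real.one_le_exp ?_).trans (le_add_of_nonneg_left (Real.exp_pos _).le)
          nlinarith
  rw [expect_one_repeatAlg hA.expect_one, expect_add, expect_add, expect_const_mul,
    expect_const_mul] at key
  have h3 : t * Real.exp (n * ((η / 2) ^ 2 * q)) = Real.exp (-(n * (η ^ 2 * q) / 4)) := by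
    rw [ht, ← Real.exp_add]
    ring_nf
  have ht0 : 0 ≤ t := (Real.exp_pos _).le
  have h4 := mul_le_mul_of_nonneg_left h1 ht0
  have h5 := mul_le_mul_of_nonneg_left h2 ht0
  rw [neg_sq] at h5
  unfold Guarantee
  linarith

lemma sum_map_ite_eq_length_filter {P : α → Prop} [DecidablePred P] (l : List α) :
    (l.map fun a => if P a then (1 : ℝ) else 0).sum = (l.filter (P ·)).length := by
  induction l with
  | nil => simp
  | cons a l ih =>
    by_cases h : P a <;> simp [h, ih, add_comm]

lemma HasLaw.guarantee_frac {D : PMF (Fin N)} {A : QueryAlg N (Fin N)} {p : Fin N → ℝ}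
    (hA : HasLaw D A p) (P : Fin N → Prop) [DecidablePred P] {m q η δ : ℝ}
    (hm : ∑ i, (if P i then p i else 0) = m) (hq : m ≤ q) (hη0 : 0 < η) (hη : η ≤ 2) {n : ℕ}
    (hn : 0 < n) (hδ : 2 * Real.exp (-(n * (η ^ 2 * q) / 4)) ≤ δ) :
    Guarantee D (repeatAlg A n)
      (fun l => |((l.filter (P ·)).length : ℝ) / l.length - m| ≤ η * q) δ := by
  have h := hA.guarantee_abs_sub_le (f := fun i => if P i then 1 else 0)
    (fun i => by split_ifs <;> norm_num) (fun i => by split_ifs <;> norm_num) (m := m)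
    (by simpa using hm) hq hη0 hη n
  refine h.mono_of_always (always_repeatAlg A n) (fun l hl hl' => ?_) hδ
  rw [sum_map_ite_eq_length_filter] at hl'
  have hn' : (0 : ℝ) < n := by exact_mod_cast hn
  rw [hl, div_sub' hn'.ne', abs_div, abs_of_pos hn', div_le_iff₀ hn']
  linarith

end QueryAlg

variable {N : ℕ}

/-! ### Correctness of Compare. -/

/-- The output of Compare on `x, y` is correct at accuracy `η` and range `K`. -/
def CompareCorrect (D : PMF (Fin N)) (x y : Fin N) (η K : ℝ) : CompareResult → Prop
  | CompareResult.low => K * (D y).toReal < (D x).toReal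
  | CompareResult.high => K * (D x).toReal < (D y).toReal
  | CompareResult.value ρ => |ρ * (D x).toReal - (D y).toReal| ≤ η * (D y).toReal

/-- If K·b ≥ a, the true fraction μ is at least u = 1/(K + 1). The error is at most μ/4 when μ ≤ 1/2
and at most 1/8 otherwise, so M ≥ 3u/4, above the cutoff 2u/3. -/
lemma compare_low {a b K M η : ℝ} (ha : 0 < a) (hb : 0 ≤ b) (hK : 1 ≤ K) (hη0 : 0 < η) (hη : η ≤ 1)
    (hM : |M - b / (a + b)| ≤
      η / 4 * max (min (b / (a + b)) (a / (a + b))) (1 / 4 * (1 / (K + 1))))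
    (hlow : M < 2 / 3 * (1 / (K + 1))) : K * b < a := by
  by_contra! h
  have hab : 0 < a + b := by linarith
  have hK1 : 0 < K + 1 := by linarith
  set u := 1 / (K + 1) with hu
  have hu0 : 0 < u := by positivity
  have hu2 : u ≤ 1 / 2 := by rw [hu, div_le_div_iff₀ hK1 two_pos]; linarith
  set μ := b / (a + b) with hμ
  have hμ1 : a / (a + b) = 1 - μ := by rw [hμ]; field_simp; ring
  have hμu : u ≤ μ := by
    rw [hu, hμ, div_le_div_iff₀ hK1 hab]
    linarith
  rw [hμ1] at hM
  have hM' := (abs_le.1 hM).1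
  rcases le_total μ (1 / 2) with h2 | h2
  · have : max (min μ (1 - μ)) (1 / 4 * u) ≤ μ := max_le (min_le_left _ _) (by linarith)
    nlinarith
  · have : max (min μ (1 - μ)) (1 / 4 * u) ≤ 1 / 2 :=
      max_le ((min_le_right _ _).trans (by linarith)) (by linarith)
    nlinarith

/-- This is `compare_low` with the two points exchanged. The case b = 0 is excluded separately,
because `compare_low` needs its first weight positive. -/
lemma compare_high {a b K M η : ℝ} (ha : 0 < a) (hb : 0 ≤ b) (hK : 1 ≤ K) (hη0 : 0 < η)
    (hη : η ≤ 1) (hM : |M - b / (a + b)| ≤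
      η / 4 * max (min (b / (a + b)) (a / (a + b))) (1 / 4 * (1 / (K + 1))))
    (hhigh : 1 - M < 2 / 3 * (1 / (K + 1))) : K * a < b := by
  rcases hb.eq_or_lt with rfl | hb
  · exfalso
    have hu2 : 1 / (K + 1) ≤ 1 / 2 := by
      rw [div_le_div_iff₀ (by linarith) two_pos]; linarith
    have h0 : (0 : ℝ) ≤ 1 / (K + 1) := by positivity
    have hM' := (abs_le.1 hM).2
    have : max (min (0 / (a + 0)) (a / (a + 0))) (1 / 4 * (1 / (K + 1))) ≤ 1 / 8 :=
      max_le ((min_le_left _ _).trans (by simp)) (by linarith)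
    rw [zero_div] at hM' this
    nlinarith
  · refine compare_low (M := 1 - M) hb ha.le hK hη0 hη ?_ hhigh
    have hab : a + b ≠ 0 := by positivity
    have : 1 - M - a / (b + a) = -(M - b / (a + b)) := by
      rw [add_comm b a]; field_simp; ring
    rw [this, abs_neg, add_comm b a, min_comm]
    exact hM

/-- Passing both cutoffs forces u/4 ≤ z = min(μ, 1 − μ), so the error of M is relative to z. The
rest follows from M/(1 − M)·a − b = (M − μ)(a + b)/(1 − M), z ≤ 2μ(1 − μ) and 1 − M ≥ 3(1 − μ)/4. -/
lemma compare_value {a b K M η : ℝ} (ha : 0 < a) (hb : 0 ≤ b) (hK : 1 ≤ K) (hη0 : 0 < η)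
    (hη : η ≤ 1) (hM : |M - b / (a + b)| ≤
      η / 4 * max (min (b / (a + b)) (a / (a + b))) (1 / 4 * (1 / (K + 1))))
    (hlow : 2 / 3 * (1 / (K + 1)) ≤ M) (hhigh : 2 / 3 * (1 / (K + 1)) ≤ 1 - M) :
    |M / (1 - M) * a - b| ≤ η * b := by
  have hab : 0 < a + b := by linarith
  have hK1 : 0 < K + 1 := by linarith
  set u := 1 / (K + 1) with hu
  have hu0 : 0 < u := by positivity
  set μ := b / (a + b) with hμ
  have hμb : μ * (a + b) = b := by rw [hμ]; field_simp
  have hμ1 : a / (a + b) = 1 - μ := by rw [hμ]; field_simp; ring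
  rw [hμ1] at hM
  have hμ0 : 0 ≤ μ := by positivity
  have hM' := abs_le.1 hM
  have hq : 1 / 4 * u ≤ min μ (1 - μ) := by
    by_contra! h
    rw [max_eq_right h.le] at hM'
    rcases min_lt_iff.1 h with h | h
    · nlinarith [hM'.2]
    · nlinarith [hM'.1]
  rw [max_eq_left hq] at hM hM'
  have h1M : 0 < 1 - M := by nlinarith
  have hmin1 := min_le_left μ (1 - μ)
  have hmin2 := min_le_right μ (1 - μ)
  set z := min μ (1 - μ)
  have hz : 0 ≤ z := by linarith
  have hrw : M / (1 - M) * a - b = (M - μ) * (a + b) / (1 - M) := by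
    rw [sub_mul (M), hμb]
    field_simp
    ring
  rw [hrw, abs_div, abs_mul, abs_of_pos h1M, abs_of_pos hab, div_le_iff₀ h1M]
  have h1 : |M - μ| * (a + b) ≤ η / 4 * z * (a + b) := mul_le_mul_of_nonneg_right hM hab.le
  have h2 : 3 / 4 * (1 - μ) ≤ 1 - M := by nlinarith [hM'.2]
  have h3 : z ≤ 2 * (μ * (1 - μ)) := by
    rcases le_total μ (1 / 2) with h | h
    · nlinarith
    · nlinarith
  calc _ ≤ η / 4 * z * (a + b) := h1
    _ ≤ η / 4 * (2 * (μ * (1 - μ))) * (a + b) := by gcongr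
    _ = η * (μ * (a + b)) * (1 / 2 * (1 - μ)) := by ring
    _ ≤ η * b * (1 - M) := by
      rw [hμb]
      exact mul_le_mul_of_nonneg_left (by linarith) (by positivity)

lemma exp_neg_le_rpow {δ : ℝ} (hδ0 : 0 < δ) {A c : ℝ} (hA : c * Real.log (1 / δ) ≤ A) :
    Real.exp (-A) ≤ δ ^ c := by
  rw [Real.rpow_def_of_pos hδ0, Real.exp_le_exp]
  rw [one_div, Real.log_inv] at hA
  linarith

/-- The fractions of the two answers have opposite errors, so Chernoff may be applied to the rarer
answer; this is why only the minimum must be below q. -/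
lemma guarantee_fracAnswers {D : PMF (Fin N)} {x y : Fin N} (hxy : x ≠ y) (hx : 0 < (D x).toReal)
    {q η δ : ℝ}
    (hq : min ((D y).toReal / ((D x).toReal + (D y).toReal))
      ((D x).toReal / ((D x).toReal + (D y).toReal)) ≤ q) (hη0 : 0 < η) (hη : η ≤ 2) {n : ℕ}
    (hn : 0 < n) (hδ : 2 * Real.exp (-(n * (η ^ 2 * q) / 4)) ≤ δ) :
    Guarantee D (repeatAlg (pcond x y hxy ret) n)
      (fun l => |(l.count y : ℝ) / l.length - (D y).toReal / ((D x).toReal + (D y).toReal)| ≤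
        η * q) δ := by
  have hy : 0 ≤ (D y).toReal := ENNReal.toReal_nonneg
  have hlaw := hasLaw_pcond hxy hx
  have hcount : ∀ l : List (Fin N), l.count y = (l.filter (· = y)).length := fun l => by
    rw [List.count_eq_countP, List.countP_eq_length_filter]
    rfl
  have hm : ∑ i, (if i = y then condProb D x y i else 0) =
      (D y).toReal / ((D x).toReal + (D y).toReal) := by
    simp [condProb]
  rcases min_le_iff.1 hq with h | h
  · refine (hlaw.guarantee_frac (· = y) hm h hη0 hη hn hδ).mono (fun l hl => ?_) le_rfl
    rw [hcount]
    exact hl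
  · have hm' : ∑ i, (if i ≠ y then condProb D x y i else 0) =
        (D x).toReal / ((D x).toReal + (D y).toReal) := by
      have h1 : ∀ i, (if i ≠ y then condProb D x y i else 0) =
          condProb D x y i - if i = y then condProb D x y i else 0 := fun i => by
        by_cases hi : i = y <;> simp [hi]
      simp only [h1, Finset.sum_sub_distrib, hlaw.sum_eq_one, hm]
      field_simp
      ring
    refine (hlaw.guarantee_frac (· ≠ y) hm' h hη0 hη hn hδ).mono_of_always
      (always_repeatAlg _ n) (fun l hl h2 => ?_) le_rfl
    have h3 : (l.count y : ℝ) + ((l.filter (· ≠ y)).length : ℝ) = l.length := by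
      rw [hcount]
      have := List.length_eq_length_filter_add (l := l) (fun i => decide (i = y))
      rw [this]
      push_cast
      congr 3
      refine congrArg (fun p => List.filter p l) (funext fun i => ?_)
      simp
    have hn' : (l.length : ℝ) ≠ 0 := by rw [hl]; exact_mod_cast hn.ne'
    have h4 : (l.count y : ℝ) / l.length - (D y).toReal / ((D x).toReal + (D y).toReal) =
        -(((l.filter (· ≠ y)).length : ℝ) / l.length -
          (D x).toReal / ((D x).toReal + (D y).toReal)) := by
      rw [← h3] at hn' ⊢
      field_simp
      ring
    rw [h4, abs_neg]
    exact h2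

theorem guarantee_compareAlg {c : ThetaConsts} (hc : 1024 ≤ c.cmp) {D : PMF (Fin N)} {x y : Fin N}
    {η K δ : ℝ} (hx : 0 < (D x).toReal) (hη0 : 0 < η) (hη : η ≤ 1) (hK : 1 ≤ K) (hδ0 : 0 < δ)
    (hδ : δ ≤ 1 / 2) : Guarantee D (compareAlg c x y η K δ) (CompareCorrect D x y η K) δ := by
  unfold compareAlg
  split_ifs with hxy
  · set r : ℝ := c.cmp * (K * Real.log (1 / δ) / η ^ 2) with hr
    have hlog : 0 < Real.log (1 / δ) := Real.log_pos (by rw [lt_div_iff₀ hδ0]; linarith)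
    have hr0 : 0 < r := mul_pos c.cmp_pos (by positivity)
    have hy : 0 ≤ (D y).toReal := ENNReal.toReal_nonneg
    have hexp : 2 * Real.exp (-((⌈r⌉₊ : ℝ) * ((η / 4) ^ 2 *
        max (min ((D y).toReal / ((D x).toReal + (D y).toReal))
          ((D x).toReal / ((D x).toReal + (D y).toReal))) (1 / 4 * (1 / (K + 1)))) / 4)) ≤ δ := by
      -- The factor 2 gives failure probability at most 2δ² ≤ δ. The constant is 1024 =
      -- 2·(16·4·2·4), where K + 1 ≤ 2K accounts for one factor 2.
      have h1 : 2 * Real.log (1 / δ) ≤ (⌈r⌉₊ : ℝ) * ((η / 4) ^ 2 *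
        max (min ((D y).toReal / ((D x).toReal + (D y).toReal))
          ((D x).toReal / ((D x).toReal + (D y).toReal))) (1 / 4 * (1 / (K + 1)))) / 4 := by
        calc 2 * Real.log (1 / δ) ≤ c.cmp / 512 * Real.log (1 / δ) := by
              gcongr; linarith
          _ = r * ((η / 4) ^ 2 * (1 / 4 * (1 / (2 * K)))) / 4 := by
              rw [hr]; field_simp; ring
          _ ≤ (⌈r⌉₊ : ℝ) * ((η / 4) ^ 2 * (1 / 4 * (1 / (K + 1)))) / 4 := by
              gcongr
              · exact Nat.le_ceil r
              · linarith
          _ ≤ _ := by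
              gcongr
              exact le_max_right _ _
      have h2 := exp_neg_le_rpow hδ0 h1
      rw [Real.rpow_two] at h2
      nlinarith
    have hfrac := guarantee_fracAnswers hxy hx (le_max_left _ _) (by positivity : 0 < η / 4)
      (by linarith) (Nat.ceil_pos.2 hr0) hexp
    refine (hfrac.bind (δ₂ := 0) (fun l hl => ?_) le_rfl).mono (fun _ h => h) (by simp)
    simp only
    split_ifs with hlow hhigh
    · exact guarantee_pure D (compare_low hx hy hK hη0 hη hl hlow)
    · exact guarantee_pure D (compare_high hx hy hK hη0 hη hl hhigh)
    · exact guarantee_pure D (compare_value hx hy hK hη0 hη hl (not_lt.1 hlow) (not_lt.1 hhigh))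
  · push Not at hxy
    subst hxy
    refine (guarantee_pure D ?_).mono (fun _ h => h) hδ0.le
    simp only [CompareCorrect, one_mul, sub_self, abs_zero]
    positivity

/-! ### Neighbourhoods and the estimation of their weight. -/

/-- `y` has the same weight as `x` up to a factor `1 + α`. -/
def Close (D : PMF (Fin N)) (x : Fin N) (α : ℝ) (y : Fin N) : Prop :=
  (D x).toReal ≤ (1 + α) * (D y).toReal ∧ (D y).toReal ≤ (1 + α) * (D x).toReal

lemma Close.mono {D : PMF (Fin N)} {x y : Fin N} {α α' : ℝ} (h : Close D x α y) (hα : α ≤ α') :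
    Close D x α' y :=
  ⟨h.1.trans (by gcongr), h.2.trans (by gcongr)⟩

/-- Half of the margin θ absorbs the relative error θ/4 of Compare, as α ≤ 1/2. Low and High are
impossible because the ratio is at most 3/2 < 4. The other half of the margin serves the converse
`close_of_inRange`. -/
lemma Close.inRange {D : PMF (Fin N)} {x y : Fin N} {α θ : ℝ} {r : CompareResult}
    (hx : 0 < (D x).toReal) (hα0 : 0 ≤ α) (hα : α ≤ 1 / 2) (hθ0 : 0 < θ) (hθ : θ ≤ 1 / 2)
    (hr : CompareCorrect D x y (θ / 4) 4 r) (h : Close D x α y) :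
    r.InRange (1 / (1 + α + θ / 2)) (1 + α + θ / 2) := by
  obtain ⟨h1, h2⟩ := h
  set a := (D x).toReal
  set b := (D y).toReal
  have hb : 0 < b := by
    by_contra! hb
    nlinarith
  cases r with
  | low =>
    change 4 * b < a at hr
    exfalso; nlinarith
  | high =>
    change 4 * a < b at hr
    exfalso; nlinarith
  | value ρ =>
    have hr' : |ρ * a - b| ≤ θ / 4 * b := hr
    obtain ⟨h3, h4⟩ := abs_le.1 hr'
    constructor
    · rw [div_le_iff₀ (by positivity)]
      refine le_of_mul_le_mul_right (a := a) ?_ hx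
      have h5 : (1 - θ / 4) * b ≤ ρ * a := by linarith
      have h6 : 1 + α ≤ (1 - θ / 4) * (1 + α + θ / 2) := by nlinarith
      calc 1 * a ≤ (1 + α) * b := by linarith
        _ ≤ (1 - θ / 4) * (1 + α + θ / 2) * b := by gcongr
        _ = (1 - θ / 4) * b * (1 + α + θ / 2) := by ring
        _ ≤ ρ * a * (1 + α + θ / 2) := by gcongr
        _ = _ := by ring
    · refine le_of_mul_le_mul_right (a := a) ?_ hx
      have h6 : (1 + θ / 4) * (1 + α) ≤ 1 + α + θ / 2 := by nlinarith
      calc ρ * a ≤ (1 + θ / 4) * b := by linarith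
        _ ≤ (1 + θ / 4) * ((1 + α) * a) := by gcongr
        _ = (1 + θ / 4) * (1 + α) * a := by ring
        _ ≤ _ := by gcongr

lemma close_of_inRange {D : PMF (Fin N)} {x y : Fin N} {α θ : ℝ} {r : CompareResult}
    (hx : 0 < (D x).toReal) (hα0 : 0 ≤ α) (hα : α ≤ 1 / 2) (hθ0 : 0 < θ) (hθ : θ ≤ 1 / 4)
    (hr : CompareCorrect D x y (θ / 4) 4 r)
    (h : r.InRange (1 / (1 + α + θ / 2)) (1 + α + θ / 2)) : Close D x (α + θ) y := by
  have hb : 0 ≤ (D y).toReal := ENNReal.toReal_nonneg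
  cases r with
  | low => exact h.elim
  | high => exact h.elim
  | value ρ =>
    have hr' : |ρ * (D x).toReal - (D y).toReal| ≤ θ / 4 * (D y).toReal := hr
    obtain ⟨h1, h2⟩ := h
    unfold Close
    set a := (D x).toReal
    set b := (D y).toReal
    obtain ⟨h3, h4⟩ := abs_le.1 hr'
    rw [div_le_iff₀ (by positivity)] at h1
    constructor
    · have h6 : (1 + θ / 4) * (1 + α + θ / 2) ≤ 1 + (α + θ) := by nlinarith
      calc a = 1 * a := by ring
        _ ≤ ρ * (1 + α + θ / 2) * a := by gcongr
        _ = ρ * a * (1 + α + θ / 2) := by ring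
        _ ≤ (1 + θ / 4) * b * (1 + α + θ / 2) :=
            mul_le_mul_of_nonneg_right (by linarith) (by positivity)
        _ = (1 + θ / 4) * (1 + α + θ / 2) * b := by ring
        _ ≤ _ := by gcongr
    · have h5 : (1 - θ / 4) * b ≤ (1 + α + θ / 2) * a := by
        calc (1 - θ / 4) * b ≤ ρ * a := by linarith
          _ ≤ _ := by gcongr
      have h6 : 1 + α + θ / 2 ≤ (1 - θ / 4) * (1 + (α + θ)) := by nlinarith
      have h7 : (1 - θ / 4) * b ≤ (1 - θ / 4) * ((1 + (α + θ)) * a) := by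
        rw [← mul_assoc]
        exact h5.trans (by gcongr)
      exact le_of_mul_le_mul_left h7 (by linarith)

open Classical in
theorem guarantee_closePoints {c : ThetaConsts} (hc : 1024 ≤ c.cmp) {D : PMF (Fin N)} {x : Fin N}
    {α θ δ : ℝ} (hx : 0 < (D x).toReal) (hα0 : 0 ≤ α) (hα : α ≤ 1 / 2) (hθ0 : 0 < θ)
    (hθ : θ ≤ 1 / 4) (hδ0 : 0 < δ) (hδ : δ ≤ 1 / 2) (l : List (Fin N)) :
    Guarantee D (closePoints c x θ α δ l)
      (fun T => (l.filter (Close D x α ·)).Sublist T ∧ T.Sublist (l.filter (Close D x (α + θ) ·)))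
      (l.length * δ) := by
  unfold closePoints
  refine guarantee_filterAlg hδ0.le fun y _ => ?_
  refine ((guarantee_compareAlg hc (y := y) hx (by positivity : 0 < θ / 4) (by linarith)
    (by norm_num : (1 : ℝ) ≤ 4) hδ0 hδ).bind (δ₂ := 0) (fun r hr => ?_) le_rfl).mono
      (fun _ h => h) (by simp)
  refine guarantee_pure D ⟨fun h => ?_, fun h => ?_⟩
  · exact decide_eq_true (h.inRange hx hα0 hα hθ0 (by linarith) hr)
  · exact close_of_inRange hx hα0 hα hθ0 hθ hr (of_decide_eq_true h)

lemma QueryAlg.Guarantee.repeatAlg {α : Type} {D : PMF (Fin N)} {A : QueryAlg N α} {P : α → Prop}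
    {δ : ℝ} (h : Guarantee D A P δ) (n : ℕ) :
    Guarantee D (repeatAlg A n) (fun l => ∀ a ∈ l, P a) (n * δ) := by
  have hδ := h.nonneg
  induction n with
  | zero =>
    exact (guarantee_pure D (a := ([] : List α)) (by simp)).mono (fun _ h => h) (by simp)
  | succ n ih =>
    refine (h.bind (δ₂ := n * δ + 0) (fun b hb => ih.bind (fun l' hl' => ?_) le_rfl)
      (by positivity)).mono (fun _ h => h) (le_of_eq (by push_cast; ring))
    refine guarantee_pure D ?_
    simpa using ⟨hb, hl'⟩

/-- Candidates are sampled from D, hence almost surely have positive weight, and no PCOND call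
involving them fails. -/
lemma guarantee_drawSamp_pos (D : PMF (Fin N)) :
    Guarantee D drawSamp (fun x => 0 < (D x).toReal) 0 := by
  unfold Guarantee
  rw [(hasLaw_drawSamp D).expect_eq, sub_zero]
  refine (sum_toReal D).symm.le.trans (Finset.sum_le_sum fun i _ => ?_)
  by_cases h : 0 < (D i).toReal
  · rw [if_pos h, mul_one]
  · rw [if_neg h, mul_zero]
    exact not_lt.1 h

/-- The increments of a monotone v with values in [0, 1] telescope to at most 1, so fewer than 1/t
of the ⌈r⌉ equally likely indices have an increment above t. -/
lemma guarantee_drawBelow_increment (D : PMF (Fin N)) {v : ℕ → ℝ} (hv : Monotone v)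
    (hv0 : 0 ≤ v 0) (hv1 : ∀ i, v i ≤ 1) {r t : ℝ} (hr : 0 < r) (ht : 0 < t) :
    Guarantee D (drawBelow r) (fun i => (i : ℝ) < r ∧ v (i + 1) - v i ≤ t) (1 / (r * t)) := by
  classical
  have hm : ⌈r⌉₊ ≠ 0 := (Nat.ceil_pos.2 hr).ne'
  have hm0 : (0 : ℝ) < ⌈r⌉₊ := by exact_mod_cast Nat.ceil_pos.2 hr
  unfold Guarantee drawBelow
  rw [dif_neg hm]
  simp only [expect]
  have hpt : ∀ l : Fin ⌈r⌉₊, 1 / (⌈r⌉₊ : ℝ) * (1 - (v (l + 1) - v l) / t) ≤ 1 / (⌈r⌉₊ : ℝ) *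
      (@ite _ (((l : ℕ) : ℝ) < r ∧ v (l + 1) - v l ≤ t) (Classical.propDecidable _) 1 0) := fun l => by
    refine mul_le_mul_of_nonneg_left ?_ (by positivity)
    have h1 : ((l : ℕ) : ℝ) < r := Nat.lt_ceil.1 l.2
    have h2 : 0 ≤ v (l + 1) - v l := sub_nonneg.2 (hv (Nat.le_succ _))
    split_ifs with h
    · have := div_nonneg h2 ht.le
      linarith
    · have h3 : t < v (l + 1) - v l := not_le.1 fun h' => h ⟨h1, h'⟩
      have := (one_lt_div ht).2 h3
      linarith
  have hsum : ∑ l : Fin ⌈r⌉₊, 1 / (⌈r⌉₊ : ℝ) * (1 - (v (l + 1) - v l) / t) =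
      1 - (v ⌈r⌉₊ - v 0) / (⌈r⌉₊ * t) := by
    rw [Fin.sum_univ_eq_sum_range (fun l => 1 / (⌈r⌉₊ : ℝ) * (1 - (v (l + 1) - v l) / t)),
      ← Finset.mul_sum, Finset.sum_sub_distrib, ← Finset.sum_div, Finset.sum_range_sub]
    simp only [Finset.sum_const, Finset.card_range, nsmul_eq_mul, mul_one]
    field_simp
  have h1 : (v ⌈r⌉₊ - v 0) / (⌈r⌉₊ * t) ≤ 1 / (r * t) := by
    have := Nat.le_ceil r
    have := hv1 ⌈r⌉₊
    gcongr
    linarith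
  calc _ ≤ ∑ l : Fin ⌈r⌉₊, 1 / (⌈r⌉₊ : ℝ) * (1 - (v (l + 1) - v l) / t) := by
        rw [hsum]; linarith
    _ ≤ _ := Finset.sum_le_sum fun l _ => hpt l

open Classical in
/-- The total weight, with respect to the weight function `p`, of the points whose `D`-weight is
within a factor `1 + α` of that of `x`. -/
noncomputable def closeWeight (D : PMF (Fin N)) (p : Fin N → ℝ) (x : Fin N) (α : ℝ) : ℝ :=
  ∑ i, if Close D x α i then p i else 0

lemma closeWeight_nonneg {D : PMF (Fin N)} {p : Fin N → ℝ} (hp : ∀ i, 0 ≤ p i) (x : Fin N) (α : ℝ) :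
    0 ≤ closeWeight D p x α :=
  Finset.sum_nonneg fun i _ => by split_ifs <;> simp [hp]

lemma closeWeight_mono {D : PMF (Fin N)} {p : Fin N → ℝ} (hp : ∀ i, 0 ≤ p i) (x : Fin N) :
    Monotone (closeWeight D p x) := fun α α' hα =>
  Finset.sum_le_sum fun i _ => by
    by_cases h : Close D x α i
    · simp [h, h.mono hα]
    · simp only [h, if_false]
      split_ifs <;> simp [hp]

lemma closeWeight_le_one {D : PMF (Fin N)} {p : Fin N → ℝ} (hp : ∀ i, 0 ≤ p i)
    (hp1 : ∑ i, p i = 1) (x : Fin N) (α : ℝ) : closeWeight D p x α ≤ 1 := by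
  rw [← hp1]
  exact Finset.sum_le_sum fun i _ => by split_ifs <;> simp [hp]

/-- The output `(w, α)` of Estimate-Neighborhood is correct. -/
def NeighborhoodCorrect (D : PMF (Fin N)) (x : Fin N) (κ β η θ : ℝ) (r : ℝ × ℝ) : Prop :=
  κ ≤ r.2 ∧ r.2 ≤ 2 * κ ∧
    closeWeight D (fun i => (D i).toReal) x (r.2 + θ) ≤
      closeWeight D (fun i => (D i).toReal) x r.2 + η * β / 16 ∧
    |r.1 - closeWeight D (fun i => (D i).toReal) x r.2| ≤
      η / 4 * max (closeWeight D (fun i => (D i).toReal) x r.2) β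

open Classical in
/-- Empirical frequencies of the neighbourhoods with parameters `α` and `α + θ` are accurate. -/
lemma guarantee_close_frac {D : PMF (Fin N)} {A : QueryAlg N (Fin N)} {p : Fin N → ℝ}
    (hA : HasLaw D A p) (x : Fin N) (α θ : ℝ) {q η δ : ℝ} (hη0 : 0 < η) (hη : η ≤ 1)
    {n : ℕ} (hn : 0 < n) (hδ : 2 * Real.exp (-(n * (η ^ 2 * q) / 1024)) ≤ δ) :
    Guarantee D (repeatAlg A n) (fun l =>
      |((l.filter (Close D x α ·)).length : ℝ) / l.length - closeWeight D p x α| ≤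
        η / 16 * max (closeWeight D p x α) q ∧
      |((l.filter (Close D x (α + θ) ·)).length : ℝ) / l.length - closeWeight D p x (α + θ)| ≤
        η / 16 * max (closeWeight D p x (α + θ)) q) (2 * δ) := by
  have key : ∀ α', Guarantee D (repeatAlg A n) (fun l =>
      |((l.filter (Close D x α' ·)).length : ℝ) / l.length - closeWeight D p x α'| ≤
        η / 16 * max (closeWeight D p x α') q) δ := fun α' => by
    refine hA.guarantee_frac (Close D x α') rfl (le_max_left _ _) (by positivity)
      (by linarith) hn (le_trans ?_ hδ)
    have : (n : ℝ) * (η ^ 2 * q) / 1024 ≤ n * ((η / 16) ^ 2 * max (closeWeight D p x α') q) / 4 := by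
      calc (n : ℝ) * (η ^ 2 * q) / 1024 = n * ((η / 16) ^ 2 * q) / 4 := by ring
        _ ≤ _ := by gcongr; exact le_max_right _ _
    exact mul_le_mul_of_nonneg_left (Real.exp_le_exp.2 (neg_le_neg this)) two_pos.le
  exact ((key α).and (key (α + θ))).mono (fun _ h => h) (by linarith)

/-- The slack 9/64 is what the uniform weights need: a gap η/16 under D grows by two factors at most
3/2 on conversion. It fits, since 1/16 + (17/16)(9/64) < 1/4. -/
lemma abs_sub_le_of_between {W W' w f f' q η e : ℝ} (hη0 : 0 < η) (hη : η ≤ 1)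
    (hWW : W ≤ W') (hW' : W' ≤ W + e) (he : e ≤ 9 / 64 * (η * max W q))
    (hf : |f - W| ≤ η / 16 * max W q) (hf' : |f' - W'| ≤ η / 16 * max W' q) (h1 : f ≤ w)
    (h2 : w ≤ f') (hq : 0 < q) : |w - W| ≤ η / 4 * max W q := by
  have hm : max W' q ≤ max W q + e := max_le (by linarith [le_max_left W q])
    (by linarith [le_max_right W q])
  have hm0 : 0 < max W q := lt_max_of_lt_right hq
  have h3 := (abs_le.1 hf).1
  have h4 := (abs_le.1 hf').2
  have h5 : η / 16 * max W' q ≤ η / 16 * (max W q + e) := by gcongr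
  have h6 : η * e ≤ e := by nlinarith
  have h7 : 0 < η * max W q := by positivity
  rw [abs_le]
  constructor <;> nlinarith

lemma thetaOf_pos {κ β η δ : ℝ} (hκ : 0 < κ) (hβ : 0 < β) (hη : 0 < η) (hδ : 0 < δ) :
    0 < thetaOf κ β η δ := by
  unfold thetaOf; positivity

lemma thetaOf_le {κ β η δ : ℝ} (hκ1 : κ ≤ 1) (hβ : 0 < β) (hβ1 : β ≤ 1) (hη : 0 < η)
    (hη1 : η ≤ 1) (hδ : 0 < δ) (hδ1 : δ ≤ 1) : thetaOf κ β η δ ≤ 1 / 4 := by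
  unfold thetaOf
  have h1 : κ * η ≤ 1 := mul_le_one₀ hκ1 hη.le hη1
  have h2 : κ * η * β ≤ 1 := mul_le_one₀ h1 hβ.le hβ1
  have h3 : κ * η * β * δ ≤ 1 := mul_le_one₀ h2 hδ.le hδ1
  linarith

theorem guarantee_estimateNeighborhood {c : ThetaConsts} (hc : 1024 ≤ c.cmp) (hc' : 2048 ≤ c.nbhd)
    {D : PMF (Fin N)} {x : Fin N} {κ β η δ : ℝ} (hx : 0 < (D x).toReal) (hκ0 : 0 < κ)
    (hκ : κ ≤ 1 / 8) (hβ0 : 0 < β) (hβ : β ≤ 1) (hη0 : 0 < η) (hη : η ≤ 1) (hδ0 : 0 < δ)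
    (hδ : δ ≤ 1 / 40) :
    Guarantee D (estimateNeighborhood c x κ β η δ)
      (NeighborhoodCorrect D x κ β η (thetaOf κ β η δ)) δ := by
  classical
  unfold estimateNeighborhood
  set θ := thetaOf κ β η δ with hθ
  have hθ0 : 0 < θ := thetaOf_pos hκ0 hβ0 hη0 hδ0
  have hθ1 : θ ≤ 1 / 4 := thetaOf_le (by linarith) hβ0 hβ hη0 hη hδ0 (by linarith)
  set r : ℝ := c.nbhd * (Real.log (1 / δ) / (β * η ^ 2)) with hr
  have hlog : 0 < Real.log (1 / δ) := Real.log_pos (by rw [lt_div_iff₀ hδ0]; linarith)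
  have hr0 : 0 < r := mul_pos c.nbhd_pos (by positivity)
  have hn : 0 < ⌈r⌉₊ := Nat.ceil_pos.2 hr0
  have hp : ∀ i, 0 ≤ (D i).toReal := fun i => ENNReal.toReal_nonneg
  have hα := guarantee_drawBelow_increment D
    (v := fun i => closeWeight D (fun i => (D i).toReal) x (κ + i * θ))
    (fun i j hij => closeWeight_mono hp x (by gcongr)) (closeWeight_nonneg hp x _)
    (fun i => closeWeight_le_one hp (sum_toReal D) x _) (div_pos hκ0 hθ0)
    (by positivity : 0 < η * β / 16)
  -- The width θ is chosen to make this exactly δ/4.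
  have hδ4 : 1 / (κ / θ * (η * β / 16)) = δ / 4 := by
    rw [hθ, thetaOf]; field_simp; norm_num
  rw [hδ4] at hα
  -- Failure budget: δ/4 for α, δ/8 for each of two frequencies, δ/4 for all calls of Compare.
  refine (hα.bind (δ₂ := 2 * (δ / 8) + (δ / 4 + 0)) (fun i hi => ?_) (by positivity)).mono
    (fun _ h => h) (by linarith)
  obtain ⟨hi1, hi2⟩ := hi
  rw [lt_div_iff₀ hθ0] at hi1
  set α : ℝ := κ + i * θ with hαdef
  have hstep : κ + ((i + 1 : ℕ) : ℝ) * θ = α + θ := by push_cast; ring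
  rw [hstep] at hi2
  have hα0 : κ ≤ α := le_add_of_nonneg_right (by positivity)
  have hα1 : α ≤ 2 * κ := by linarith
  have hexp : 2 * Real.exp (-((⌈r⌉₊ : ℝ) * (η ^ 2 * β) / 1024)) ≤ δ / 8 := by
    have h1 : 2 * Real.log (1 / δ) ≤ (⌈r⌉₊ : ℝ) * (η ^ 2 * β) / 1024 := by
      calc 2 * Real.log (1 / δ) ≤ c.nbhd / 1024 * Real.log (1 / δ) := by gcongr; linarith
        _ = r * (η ^ 2 * β) / 1024 := by rw [hr]; field_simp
        _ ≤ _ := by gcongr; exact Nat.le_ceil r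
    have h2 := exp_neg_le_rpow hδ0 h1
    rw [Real.rpow_two] at h2
    nlinarith
  -- The set accepted by Compare depends on the sample, but the two sets that sandwich it depend
  -- only on α, which is drawn earlier, so Chernoff applies to those.
  have hfrac := guarantee_close_frac (hasLaw_drawSamp D) x α θ hη0 hη hn hexp
  refine Guarantee.bind (hfrac.mono_of_always (always_repeatAlg _ _)
    (fun l hl h => And.intro hl h) le_rfl) (fun S hS => ?_) (by positivity)
  obtain ⟨hlen, hf, hf'⟩ := hS
  have hlen0 : (0 : ℝ) < S.length := by rw [hlen]; exact_mod_cast hn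
  have hlen1 : (1 : ℝ) ≤ S.length := by rw [hlen]; exact_mod_cast hn
  have hδ' : δ / (4 * S.length) ≤ 1 / 2 := by
    rw [div_le_div_iff₀ (by positivity) two_pos]; linarith
  have hclose := guarantee_closePoints hc hx (by linarith : 0 ≤ α) (by linarith) hθ0 hθ1
    (by positivity : 0 < δ / (4 * S.length)) hδ' S.dedup
  refine (hclose.mono (fun _ h => h) (?_ : _ ≤ δ / 4)).bind (fun T hT => ?_) le_rfl
  · have : (S.dedup.length : ℝ) ≤ S.length := by exact_mod_cast (List.dedup_sublist S).length_le
    calc _ ≤ (S.length : ℝ) * (δ / (4 * S.length)) := by gcongr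
      _ = δ / 4 := by field_simp
  refine guarantee_pure D ⟨hα0, hα1, by linarith, ?_⟩
  have h1 : (S.filter (Close D x α ·)).length ≤ (S.filter (· ∈ T)).length := by
    rw [← List.countP_eq_length_filter, ← List.countP_eq_length_filter]
    refine List.countP_mono_left fun y hy hc => decide_eq_true (hT.1.subset ?_)
    simpa [hy] using hc
  have h2 : (S.filter (· ∈ T)).length ≤ (S.filter (Close D x (α + θ) ·)).length := by
    rw [← List.countP_eq_length_filter, ← List.countP_eq_length_filter]
    refine List.countP_mono_left fun y hy hc => ?_
    have := hT.2.subset (of_decide_eq_true hc)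
    exact (List.mem_filter.1 this).2
  refine abs_sub_le_of_between hη0 hη (closeWeight_mono hp x (by linarith : α ≤ α + θ))
    (by linarith : _ ≤ _ + η * β / 16) ?_ hf hf'
    (by simp only; gcongr) (by simp only; gcongr) hβ0
  have : η * β ≤ η * max (closeWeight D (fun i => (D i).toReal) x α) β := by
    gcongr; exact le_max_right _ _
  have : 0 < η * β := by positivity
  linarith

/-! ### Estimating the weight of one candidate. -/

lemma two_le_log_inv {κ : ℝ} (hκ0 : 0 < κ) (hκ : κ ≤ 1 / 8) : 2 ≤ Real.log (1 / κ) := by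
  have h1 : Real.log 8 ≤ Real.log (1 / κ) :=
    Real.log_le_log (by norm_num) (by rw [le_div_iff₀ hκ0]; linarith)
  have h2 : Real.log 8 = 3 * Real.log 2 := by
    rw [show (8 : ℝ) = 2 ^ 3 by norm_num, Real.log_pow]; norm_num
  linarith [Real.log_two_gt_d9]

lemma log_inv_le {κ : ℝ} (hκ0 : 0 < κ) : Real.log (1 / κ) ≤ 1 / κ :=
  (Real.log_le_sub_one_of_pos (by positivity)).trans (by linarith)

/-- Each point of the neighbourhood has weight D(x) up to a factor 1 + α. With the reverse bound
`mul_le_closeWeight`, this makes w/(μN) an estimate of D(x). -/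
lemma closeWeight_le_mul [NeZero N] (D : PMF (Fin N)) (x : Fin N) (α : ℝ) :
    closeWeight D (fun i => (D i).toReal) x α ≤
      (1 + α) * (closeWeight D (fun _ => 1 / (N : ℝ)) x α * (N * (D x).toReal)) := by
  have hN : (N : ℝ) ≠ 0 := by exact_mod_cast NeZero.ne N
  unfold closeWeight
  rw [Finset.sum_mul, Finset.mul_sum]
  refine Finset.sum_le_sum fun i _ => ?_
  split_ifs with h
  · refine h.2.trans (le_of_eq ?_)
    field_simp
  · simp

lemma mul_le_closeWeight [NeZero N] (D : PMF (Fin N)) (x : Fin N) (α : ℝ) :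
    closeWeight D (fun _ => 1 / (N : ℝ)) x α * (N * (D x).toReal) ≤
      (1 + α) * closeWeight D (fun i => (D i).toReal) x α := by
  have hN : (N : ℝ) ≠ 0 := by exact_mod_cast NeZero.ne N
  unfold closeWeight
  rw [Finset.sum_mul, Finset.mul_sum]
  refine Finset.sum_le_sum fun i _ => ?_
  split_ifs with h
  · refine le_trans (le_of_eq ?_) h.1
    field_simp
  · simp

/-- The same comparison restricted to an annulus: if it is light under D, it is light under the
uniform distribution in units of 1/(N·D(x)). -/
lemma closeWeight_sub_le [NeZero N] (D : PMF (Fin N)) (x : Fin N) {α α' : ℝ} (hα : α ≤ α') :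
    (closeWeight D (fun _ => 1 / (N : ℝ)) x α' - closeWeight D (fun _ => 1 / (N : ℝ)) x α) *
        (N * (D x).toReal) ≤
      (1 + α') * (closeWeight D (fun i => (D i).toReal) x α' -
        closeWeight D (fun i => (D i).toReal) x α) := by
  have hN : (N : ℝ) ≠ 0 := by exact_mod_cast NeZero.ne N
  unfold closeWeight
  rw [← Finset.sum_sub_distrib, ← Finset.sum_sub_distrib, Finset.sum_mul, Finset.mul_sum]
  refine Finset.sum_le_sum fun i _ => ?_
  by_cases h : Close D x α i
  · simp [h, h.mono hα]
  · by_cases h' : Close D x α' i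
    · simp only [h, h', if_true, if_false, sub_zero]
      refine le_trans (le_of_eq ?_) h'.1
      field_simp
    · simp [h, h']

/-- A point that is likely to be accepted as a reference point. -/
def GoodReference (D : PMF (Fin N)) (κ : ℝ) (x : Fin N) : Prop :=
  κ / (2 * N) ≤ (D x).toReal ∧ (D x).toReal ≤ 1 / (κ * N) ∧
    κ ^ 2 / (5 * Real.log (1 / κ)) ≤ closeWeight D (fun i => (D i).toReal) x κ

/-- The treatment of the candidate `x` was correct. -/
def CandidateCorrect (D : PMF (Fin N)) (κ : ℝ) (x : Fin N) (r : Option (Fin N × ℝ)) : Prop :=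
  (∀ p ∈ r, p.1 = x ∧ |p.2 - (D x).toReal| ≤ 4 * κ * (D x).toReal) ∧
    (GoodReference D κ x → r ≠ none)

/-- An estimate that passes the threshold 2β cannot come from W < β, so the additive part of the
error disappears and the error is purely relative. -/
lemma abs_sub_le_mul_of_two_mul_le {w W β κ : ℝ} (hβ0 : 0 < β) (hκ : κ ≤ 1)
    (h : |w - W| ≤ κ / 4 * max W β) (hw : 2 * β ≤ w) : β ≤ W ∧ |w - W| ≤ κ / 4 * W := by
  have hW : β ≤ W := by
    by_contra! hlt
    rw [max_eq_right hlt.le] at h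
    nlinarith [(abs_le.1 h).2]
  exact ⟨hW, by rwa [max_eq_left hW] at h⟩

/-- Relative errors κ/4 in w, κ/4 in μ and 2κ in W ≈ U·M·a multiply to at most 1 ± 4κ. -/
lemma abs_ratio_sub_le {w W μ U M a κ : ℝ} (hκ0 : 0 < κ) (hκ : κ ≤ 1 / 8) (hU : 0 < U) (hM : 0 < M)
    (ha : 0 < a) (hw : |w - W| ≤ κ / 4 * W) (hμ : |μ - U| ≤ κ / 4 * U)
    (h1 : W ≤ (1 + 2 * κ) * (U * (M * a))) (h2 : U * (M * a) ≤ (1 + 2 * κ) * W) :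
    |w / (μ * M) - a| ≤ 4 * κ * a := by
  obtain ⟨hw1, hw2⟩ := abs_le.1 hw
  obtain ⟨hμ1, hμ2⟩ := abs_le.1 hμ
  have hμ0 : 0 < μ := by nlinarith
  have hV : 0 < U * (M * a) := by positivity
  have hMa : 0 < M * a := by positivity
  have hW : 0 < W := by
    by_contra! hW
    nlinarith
  have h5 : μ * (M * a) ≤ (1 + κ / 4) * (U * (M * a)) := by
    rw [← mul_assoc (1 + κ / 4)]
    exact mul_le_mul_of_nonneg_right (by linarith) hMa.le
  have h6 : (1 - κ / 4) * (U * (M * a)) ≤ μ * (M * a) := by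
    rw [← mul_assoc (1 - κ / 4)]
    exact mul_le_mul_of_nonneg_right (by linarith) hMa.le
  have hup : w ≤ (1 + 4 * κ) * (μ * (M * a)) := by
    calc w ≤ (1 + κ / 4) * W := by linarith
      _ ≤ (1 + κ / 4) * ((1 + 2 * κ) * (U * (M * a))) := by gcongr
      _ = ((1 + κ / 4) * (1 + 2 * κ)) * (U * (M * a)) := by ring
      _ ≤ ((1 + 4 * κ) * (1 - κ / 4)) * (U * (M * a)) :=
          mul_le_mul_of_nonneg_right (by nlinarith) hV.le
      _ = (1 + 4 * κ) * ((1 - κ / 4) * (U * (M * a))) := by ring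
      _ ≤ _ := by gcongr
  have hlow : (1 - 4 * κ) * (μ * (M * a)) ≤ w := by
    calc (1 - 4 * κ) * (μ * (M * a)) ≤ (1 - 4 * κ) * ((1 + κ / 4) * (U * (M * a))) :=
          mul_le_mul_of_nonneg_left h5 (by linarith)
      _ ≤ (1 - 4 * κ) * ((1 + κ / 4) * ((1 + 2 * κ) * W)) :=
          mul_le_mul_of_nonneg_left (by gcongr) (by linarith)
      _ = ((1 - 4 * κ) * (1 + κ / 4) * (1 + 2 * κ)) * W := by ring
      _ ≤ (1 - κ / 4) * W := by
          refine mul_le_mul_of_nonneg_right ?_ hW.le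
          nlinarith [pow_pos hκ0 2, pow_pos hκ0 3]
      _ ≤ w := by linarith
  have hden : 0 < μ * M := by positivity
  rw [abs_le]
  constructor
  · rw [neg_le_sub_iff_le_add, ← sub_le_iff_le_add, le_div_iff₀ hden]
    linarith
  · rw [sub_le_iff_le_add, div_le_iff₀ hden]
    linarith

-- The acceptance thresholds turn additive errors into relative ones, so any accepted estimate is
-- accurate. A good reference exceeds each threshold with room for these errors, so it is accepted.
set_option maxHeartbeats 600000 in
theorem guarantee_examineCandidate [NeZero N] {c : ThetaConsts} (hc : 1024 ≤ c.cmp)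
    (hc' : 2048 ≤ c.nbhd) (hc'' : 286720 ≤ c.unif) {D : PMF (Fin N)} {x : Fin N} {κ : ℝ} {s : ℕ}
    (hx : 0 < (D x).toReal) (hκ0 : 0 < κ) (hκ : κ ≤ 1 / 8) (hs0 : 0 < s)
    (hs : 160 * (s : ℝ) ≤ (1 / κ) ^ 7) :
    Guarantee D (examineCandidate c κ s x) (CandidateCorrect D κ x) (3 / (40 * s)) := by
  classical
  unfold examineCandidate
  have hs1 : (1 : ℝ) ≤ s := by exact_mod_cast hs0
  have hL := two_le_log_inv hκ0 hκ
  simp only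
  set L := Real.log (1 / κ) with hLdef
  set β := κ ^ 2 / (40 * L) with hβ
  set δ := 1 / (40 * (s : ℝ)) with hδ
  set θ := thetaOf κ β κ δ with hθ
  have hβ0 : 0 < β := by positivity
  have hβ1 : β ≤ 1 := by
    rw [hβ, div_le_one (by positivity)]
    nlinarith
  have hδ0 : 0 < δ := by positivity
  have hδ1 : δ ≤ 1 / 40 := by
    rw [hδ, div_le_div_iff₀ (by positivity) (by norm_num)]
    linarith
  have hθ0 : 0 < θ := thetaOf_pos hκ0 hβ0 hκ0 hδ0
  have hθ1 : θ ≤ 1 / 4 := thetaOf_le (by linarith) hβ0 hβ1 hκ0 (by linarith) hδ0 (by linarith)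
  have hN : (0 : ℝ) < N := by exact_mod_cast Nat.pos_of_ne_zero (NeZero.ne N)
  have h2β : κ ^ 2 / (20 * L) = 2 * β := by rw [hβ]; field_simp; norm_num
  have h2ν : κ ^ 3 / (20 * L) = 2 * (κ * β) := by rw [hβ]; field_simp; norm_num
  have h8β : κ ^ 2 / (5 * L) = 8 * β := by rw [hβ]; field_simp; norm_num
  have h3δ : 3 / (40 * (s : ℝ)) = δ + (2 * (δ / 2) + (δ + 0)) := by rw [hδ]; ring
  rw [h2β, h2ν, h3δ]
  refine (guarantee_estimateNeighborhood hc hc' hx hκ0 hκ hβ0 hβ1 hκ0 (by linarith) hδ0 hδ1).bind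
    (fun r hr => ?_) (by positivity)
  obtain ⟨w, α⟩ := r
  obtain ⟨hα0, hα1, hWW, hwW⟩ := hr
  simp only at hα0 hα1 hWW hwW ⊢
  have hp : ∀ i, 0 ≤ (D i).toReal := fun i => ENNReal.toReal_nonneg
  have hpu : ∀ i : Fin N, (0 : ℝ) ≤ 1 / N := fun i => by positivity
  have hgood : GoodReference D κ x → 8 * β ≤ closeWeight D (fun i => (D i).toReal) x α := fun h => by
    rw [← h8β]
    exact h.2.2.trans (closeWeight_mono hp x hα0)
  have hU0 := closeWeight_le_mul D x α
  have hU1 := mul_le_closeWeight D x α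
  have hU2 := closeWeight_sub_le D x (by linarith : α ≤ α + θ)
  have hUmono := closeWeight_mono hpu x (D := D) (by linarith : α ≤ α + θ)
  have hUnn := closeWeight_nonneg hpu x α (D := D)
  set W := closeWeight D (fun i => (D i).toReal) x α
  set W' := closeWeight D (fun i => (D i).toReal) x (α + θ)
  split_ifs with hw
  · refine (guarantee_pure D ⟨fun p hp => by simp at hp, fun h => ?_⟩).mono (fun _ h => h)
      (by positivity)
    exfalso
    have := hgood h
    rw [max_eq_left (by linarith : β ≤ W)] at hwW
    have hκW : κ * W ≤ 1 / 8 * W := mul_le_mul_of_nonneg_right hκ (by linarith)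
    linarith [(abs_le.1 hwW).1]
  rw [not_lt] at hw
  obtain ⟨hβW, hwW'⟩ := abs_sub_le_mul_of_two_mul_le hβ0 (by linarith) hwW hw
  set r : ℝ := c.unif * (L ^ 2 / κ ^ 5) with hr
  have hr0 : 0 < r := mul_pos c.unif_pos (by positivity)
  have hexp : 2 * Real.exp (-((⌈r⌉₊ : ℝ) * (κ ^ 2 * (κ * β)) / 1024)) ≤ δ / 2 := by
    -- The size of `Y` does not involve the number s of candidates. The resulting tail κ⁷ is
    -- compared with 1/s through `hs`; the constant is 286720 = 7·1024·40.
    have h1 : 7 * Real.log (1 / κ) ≤ (⌈r⌉₊ : ℝ) * (κ ^ 2 * (κ * β)) / 1024 := by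
      calc 7 * L ≤ c.unif / 40960 * L := by gcongr; linarith
        _ = r * (κ ^ 2 * (κ * β)) / 1024 := by
            rw [hr, hβ]; field_simp; norm_num
        _ ≤ _ := by gcongr; exact Nat.le_ceil r
    have h2 := exp_neg_le_rpow hκ0 h1
    have h3 : κ ^ (7 : ℝ) = κ ^ 7 := by exact_mod_cast Real.rpow_natCast κ 7
    have h4 : κ ^ 7 * (160 * s) ≤ 1 := by
      calc κ ^ 7 * (160 * s) ≤ κ ^ 7 * (1 / κ) ^ 7 := by gcongr
        _ = 1 := by rw [← mul_pow, mul_one_div_cancel hκ0.ne', one_pow]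
    rw [h3] at h2
    have h5 : 2 * κ ^ 7 ≤ δ / 2 := by
      rw [hδ, div_div, le_div_iff₀ (by positivity)]
      linarith
    linarith
  have hfrac := guarantee_close_frac (hasLaw_drawUniform D) x α θ hκ0 (by linarith)
    (Nat.ceil_pos.2 hr0) hexp
  refine Guarantee.bind (hfrac.mono_of_always (always_repeatAlg _ _)
    (fun l hl h => And.intro hl h) le_rfl) (fun Y hY => ?_) (by positivity)
  obtain ⟨hlen, hf, hf'⟩ := hY
  set U := closeWeight D (fun _ => 1 / (N : ℝ)) x α
  set U' := closeWeight D (fun _ => 1 / (N : ℝ)) x (α + θ)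
  have hlen1 : (1 : ℝ) ≤ Y.length := by rw [hlen]; exact_mod_cast Nat.ceil_pos.2 hr0
  have hδ' : 1 / (40 * (s : ℝ) * Y.length) ≤ 1 / 2 := by
    have : 1 ≤ (s : ℝ) * Y.length := one_le_mul_of_one_le_of_one_le hs1 hlen1
    rw [div_le_div_iff₀ (by positivity) two_pos]
    linarith
  have hclose := guarantee_closePoints hc hx (by linarith : 0 ≤ α) (by linarith) hθ0 hθ1
    (by positivity : 0 < 1 / (40 * (s : ℝ) * Y.length)) hδ' Y
  refine (hclose.mono (fun _ h => h) (?_ : _ ≤ δ)).bind (fun T hT => ?_) le_rfl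
  · rw [hδ]
    exact le_of_eq (by field_simp)
  have h1 : (Y.filter (Close D x α ·)).length ≤ T.length := hT.1.length_le
  have h2 : T.length ≤ (Y.filter (Close D x (α + θ) ·)).length := hT.2.length_le
  set a := (D x).toReal
  have hNa : 0 < N * a := by positivity
  have hW0 : 0 < W := by linarith
  have hUW : W ≤ (1 + 2 * κ) * (U * (N * a)) := hU0.trans (by gcongr)
  have hWU : U * (N * a) ≤ (1 + 2 * κ) * W := hU1.trans (by gcongr)
  have hUpos : 0 < U := by
    by_contra! h
    have : U = 0 := le_antisymm h hUnn
    rw [this] at hUW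
    linarith
  have hUU : U' ≤ U + 9 / 64 * (κ * U) := by
    -- Both 1 + α + θ and 1 + 2κ are at most 3/2, and (3/2)²/16 = 9/64.
    have h3 : (U' - U) * (N * a) ≤ 9 / 64 * (κ * U) * (N * a) := by
      calc (U' - U) * (N * a) ≤ (1 + (α + θ)) * (W' - W) := hU2
        _ ≤ (1 + (α + θ)) * (κ * β / 16) :=
            mul_le_mul_of_nonneg_left (by linarith) (by linarith)
        _ ≤ 3 / 2 * (κ * W / 16) := by
            have : κ * β ≤ κ * W := mul_le_mul_of_nonneg_left hβW hκ0.le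
            exact mul_le_mul (by linarith) (by linarith) (by positivity) (by norm_num)
        _ ≤ 3 / 2 * (κ * (3 / 2 * (U * (N * a))) / 16) := by
            gcongr
            refine hUW.trans ?_
            gcongr
            linarith
        _ = _ := by ring
    linarith [le_of_mul_le_mul_right h3 hNa]
  have hμU := abs_sub_le_of_between hκ0 (by linarith) hUmono hUU (by gcongr; exact le_max_left _ _)
    hf hf' (by gcongr : _ ≤ (T.length : ℝ) / Y.length) (by gcongr) (by positivity : 0 < κ * β)
  set μ : ℝ := (T.length : ℝ) / Y.length
  split_ifs with hacc
  · refine guarantee_pure D ⟨fun p hp => ?_, fun _ => by simp⟩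
    rw [Option.mem_some_iff] at hp
    subst hp
    obtain ⟨-, hμU'⟩ := abs_sub_le_mul_of_two_mul_le (by positivity) (by linarith) hμU hacc.1
    exact ⟨rfl, abs_ratio_sub_le hκ0 hκ hUpos hN hx hwW' hμU' hUW hWU⟩
  · refine guarantee_pure D ⟨fun p hp => by simp at hp, fun hg => (hacc ?_).elim⟩
    have hW8 := hgood hg
    obtain ⟨hg1, hg2, -⟩ := hg
    rw [div_le_iff₀ (by positivity)] at hg1
    rw [le_div_iff₀ (by positivity)] at hg2
    -- As N·D(x) ≤ 1/κ, passing from D to uniform weight loses at most about a factor κ; hence the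
    -- scale κβ in the test on μ.
    have hU6 : 6 * (κ * β) ≤ U := by
      have h4 : 8 * β ≤ 5 / 4 * (U * (N * a)) := by
        refine hW8.trans (hUW.trans ?_)
        gcongr
        linarith
      have h5 : κ * (U * (N * a)) ≤ U := by
        calc κ * (U * (N * a)) = U * (a * (κ * N)) := by ring
          _ ≤ U := mul_le_of_le_one_right hUnn hg2
      have h6 := mul_le_mul_of_nonneg_left h4 hκ0.le
      linarith
    have hμU' : |μ - U| ≤ κ / 4 * U := by
      rwa [max_eq_left (by linarith [mul_pos hκ0 hβ0] : κ * β ≤ U)] at hμU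
    have hκU : κ * U ≤ 1 / 8 * U := mul_le_mul_of_nonneg_right hκ hUnn
    have hκa : κ * a ≤ 1 / 8 * a := mul_le_mul_of_nonneg_right hκ hx.le
    have hμ2 : 2 * (κ * β) ≤ μ := by linarith [(abs_le.1 hμU').1, mul_pos hκ0 hβ0]
    have hd := abs_ratio_sub_le hκ0 hκ hUpos hN hx hwW' hμU' hUW hWU
    obtain ⟨hd1, hd2⟩ := abs_le.1 hd
    refine ⟨hμ2, ?_, ?_⟩
    · have : 1 / 2 * a ≤ w / (μ * N) := by linarith
      rw [div_le_iff₀ (by positivity)]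
      calc κ ≤ 1 / 2 * a * (4 * N) := by linarith
        _ ≤ _ := by gcongr
    · rw [le_div_iff₀ (by positivity)]
      have : w / (μ * N) ≤ 3 / 2 * a := by linarith
      calc _ ≤ 3 / 2 * a * (κ * N) := by gcongr
        _ ≤ 2 := by linarith

/-! ### Existence of good references and correctness of Find-Reference. -/

lemma uniform_toReal [NeZero N] (i : Fin N) :
    (PMF.uniformOfFintype (Fin N) i).toReal = 1 / (N : ℝ) := by
  simp [PMF.uniformOfFintype_apply]

lemma sum_uniform [NeZero N] (c : ℝ) : ∑ _i : Fin N, c / (N : ℝ) = c := by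
  have : (N : ℝ) ≠ 0 := by exact_mod_cast NeZero.ne N
  rw [Finset.sum_const, Finset.card_univ, Fintype.card_fin, nsmul_eq_mul]
  field_simp

lemma one_sub_tvDist_uniform [NeZero N] (D : PMF (Fin N)) :
    1 - tvDist D (PMF.uniformOfFintype (Fin N)) = ∑ i, min (D i).toReal (1 / (N : ℝ)) := by
  have h : ∀ i, |(D i).toReal - 1 / (N : ℝ)| =
      (D i).toReal + 1 / (N : ℝ) - 2 * min (D i).toReal (1 / (N : ℝ)) := fun i => by
    rcases le_total (D i).toReal (1 / (N : ℝ)) with h | h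
    · rw [min_eq_left h, abs_of_nonpos (by linarith)]; ring
    · rw [min_eq_right h, abs_of_nonneg (by linarith)]; ring
  unfold tvDist
  simp only [uniform_toReal, h, Finset.sum_sub_distrib, Finset.sum_add_distrib, sum_toReal,
    sum_uniform, ← Finset.mul_sum]
  ring

/-- Logarithms in one bucket differ by at most κ/2, and exp(κ/2) ≤ 1 + κ. `B ≥ 1` rules out
truncation of a negative value to 0; for `A` truncation is harmless. -/
lemma le_mul_of_floor_log_eq {κ A B : ℝ} (hκ0 : 0 < κ) (hκ : κ ≤ 1) (hA : 0 < A) (hB : 1 ≤ B)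
    (h : ⌊Real.log A * (2 / κ)⌋₊ = ⌊Real.log B * (2 / κ)⌋₊) : A ≤ (1 + κ) * B := by
  have h1 := Nat.lt_floor_add_one (Real.log A * (2 / κ))
  rw [h] at h1
  have h2 := Nat.floor_le (mul_nonneg (Real.log_nonneg hB) (by positivity : 0 ≤ 2 / κ))
  have h3 : Real.log A ≤ κ / 2 + Real.log B := by
    refine le_of_mul_le_mul_right (a := 2 / κ) ?_ (by positivity)
    rw [add_mul, show κ / 2 * (2 / κ) = 1 by field_simp]
    linarith
  have h4 : Real.exp (κ / 2) ≤ 1 + κ := by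
    have := exp_le_one_add_add_sq (x := κ / 2) (abs_le.2 ⟨by linarith, by linarith⟩)
    nlinarith
  calc A = Real.exp (Real.log A) := (Real.exp_log hA).symm
    _ ≤ Real.exp (κ / 2 + Real.log B) := Real.exp_le_exp.2 h3
    _ = Real.exp (κ / 2) * B := by rw [Real.exp_add, Real.exp_log (by linarith)]
    _ ≤ _ := by gcongr

open Classical in
/-- Points of moderate weight with a light neighbourhood have small total weight. -/
lemma sum_light_le [NeZero N] (D : PMF (Fin N)) {κ ω : ℝ} (hκ0 : 0 < κ) (hκ : κ ≤ 1 / 8)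
    (hω : 0 ≤ ω) :
    ∑ i, (if κ / (2 * N) ≤ (D i).toReal ∧ (D i).toReal ≤ 1 / (κ * N) ∧
      closeWeight D (fun i => (D i).toReal) i κ < ω then (D i).toReal else 0) ≤
      6 * Real.log (1 / κ) / κ * ω := by
  have hN : (0 : ℝ) < N := by exact_mod_cast Nat.pos_of_ne_zero (NeZero.ne N)
  have hL := two_le_log_inv hκ0 hκ
  rw [← Finset.sum_filter]
  set M := Finset.univ.filter fun i => κ / (2 * N) ≤ (D i).toReal ∧ (D i).toReal ≤ 1 / (κ * N) ∧
      closeWeight D (fun i => (D i).toReal) i κ < ω with hM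
  have hC : 0 < 2 * N / κ := by positivity
  have hlow : ∀ i ∈ M, 1 ≤ (D i).toReal * (2 * N / κ) := fun i hi => by
    have := (Finset.mem_filter.1 hi).2.1
    rw [div_le_iff₀ (by positivity)] at this
    rw [← mul_div_assoc, le_div_iff₀ hκ0]
    linarith
  set b : Fin N → ℕ := fun i => ⌊Real.log ((D i).toReal * (2 * N / κ)) * (2 / κ)⌋₊ with hb
  set R : ℝ := 5 * Real.log (1 / κ) / κ with hR
  have hmaps : ∀ i ∈ M, b i ∈ Finset.range (⌊R⌋₊ + 1) := fun i hi => by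
    rw [Finset.mem_range, Nat.lt_add_one_iff]
    refine Nat.floor_le_floor ?_
    have h1 := (Finset.mem_filter.1 hi).2.2.1
    have h2 : (D i).toReal * (2 * N / κ) ≤ 2 * (1 / κ) * (1 / κ) := by
      calc _ ≤ 1 / (κ * N) * (2 * N / κ) := by gcongr
        _ = _ := by field_simp
    have h3 := Real.log_le_log (by linarith [hlow i hi]) h2
    rw [Real.log_mul (x := 2 * (1 / κ)) (by positivity) (by positivity),
      Real.log_mul (x := 2) two_ne_zero (by positivity)] at h3
    -- This uses log 2 ≤ 1 ≤ log(1/κ)/2 to absorb the factor 2.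
    have h4 : Real.log ((D i).toReal * (2 * N / κ)) ≤ 5 / 2 * Real.log (1 / κ) := by
      linarith [Real.log_two_lt_d9]
    calc _ ≤ 5 / 2 * Real.log (1 / κ) * (2 / κ) := by gcongr
      _ = R := by rw [hR]; ring
  have hclose : ∀ i ∈ M, ∀ j ∈ M, b i = b j → (D i).toReal ≤ (1 + κ) * (D j).toReal :=
    fun i hi j hj hij => by
      have := le_mul_of_floor_log_eq hκ0 (by linarith) (by linarith [hlow i hi]) (hlow j hj) hij
      rw [← mul_assoc] at this
      exact le_of_mul_le_mul_right this hC
  rw [← Finset.sum_fiberwise_of_maps_to hmaps]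
  -- A nonempty bucket lies in the κ-neighbourhood of any of its members, which weighs less than ω
  -- by the choice of `M`.
  have hfib : ∀ j ∈ Finset.range (⌊R⌋₊ + 1), ∑ i ∈ M with b i = j, (D i).toReal ≤ ω := fun j _ => by
    rcases (M.filter fun i => b i = j).eq_empty_or_nonempty with he | ⟨x, hx⟩
    · rw [he, Finset.sum_empty]
      exact hω
    · obtain ⟨hxM, hxj⟩ := Finset.mem_filter.1 hx
      refine le_trans ?_ (Finset.mem_filter.1 hxM).2.2.2.le
      rw [closeWeight, ← Finset.sum_filter]
      refine Finset.sum_le_sum_of_subset_of_nonneg (fun i hi => ?_)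
        fun i _ _ => ENNReal.toReal_nonneg
      obtain ⟨hiM, hij⟩ := Finset.mem_filter.1 hi
      exact Finset.mem_filter.2 ⟨Finset.mem_univ _, hclose x hxM i hiM (hxj.trans hij.symm),
        hclose i hiM x hxM (hij.trans hxj.symm)⟩
  refine (Finset.sum_le_card_nsmul _ _ _ hfib).trans ?_
  rw [Finset.card_range, nsmul_eq_mul]
  gcongr
  push_cast
  have h1 : (⌊R⌋₊ : ℝ) ≤ R := Nat.floor_le (by positivity)
  have h2 : 1 ≤ Real.log (1 / κ) / κ := by
    rw [le_div_iff₀ hκ0]; linarith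
  have h3 : 6 * Real.log (1 / κ) / κ = R + Real.log (1 / κ) / κ := by rw [hR]; ring
  linarith

-- Of ∑ min(D(i), 1/N) ≥ 4κ, light points take at most κ/2, heavy points at most κ since 1/N ≤
-- κD(i), and points with a light neighbourhood at most 6κ/5. More than κ remains.
open Classical in
lemma le_sum_goodReference [NeZero N] (D : PMF (Fin N)) {κ : ℝ} (hκ0 : 0 < κ) (hκ : κ ≤ 1 / 8)
    (hD : 4 * κ ≤ 1 - tvDist D (PMF.uniformOfFintype (Fin N))) :
    κ ≤ ∑ i, if GoodReference D κ i then (D i).toReal else 0 := by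
  have hN : (0 : ℝ) < N := by exact_mod_cast Nat.pos_of_ne_zero (NeZero.ne N)
  have hL := two_le_log_inv hκ0 hκ
  have hω : 0 ≤ κ ^ 2 / (5 * Real.log (1 / κ)) := by positivity
  have hlight := sum_light_le D hκ0 hκ hω
  have hlight' : 6 * Real.log (1 / κ) / κ * (κ ^ 2 / (5 * Real.log (1 / κ))) = 6 / 5 * κ := by
    field_simp
  rw [hlight'] at hlight
  rw [one_sub_tvDist_uniform] at hD
  have hpt : ∀ i, min (D i).toReal (1 / (N : ℝ)) ≤ κ / 2 / N + κ * (D i).toReal +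
      (if κ / (2 * N) ≤ (D i).toReal ∧ (D i).toReal ≤ 1 / (κ * N) ∧
        closeWeight D (fun i => (D i).toReal) i κ < κ ^ 2 / (5 * Real.log (1 / κ))
        then (D i).toReal else 0) + if GoodReference D κ i then (D i).toReal else 0 := fun i => by
    have h0 : 0 ≤ (D i).toReal := ENNReal.toReal_nonneg
    have h1 : 0 ≤ κ / 2 / N := by positivity
    have h2 : 0 ≤ κ * (D i).toReal := by positivity
    have hmin := min_le_left (D i).toReal (1 / (N : ℝ))
    by_cases hg : GoodReference D κ i
    · simp only [hg, if_true]
      have : 0 ≤ (if κ / (2 * N) ≤ (D i).toReal ∧ (D i).toReal ≤ 1 / (κ * N) ∧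
        closeWeight D (fun i => (D i).toReal) i κ < κ ^ 2 / (5 * Real.log (1 / κ))
        then (D i).toReal else 0) := by split_ifs <;> simp
      linarith
    · simp only [hg, if_false]
      split_ifs with hl
      · linarith
      · rcases lt_or_ge (D i).toReal (κ / (2 * N)) with h3 | h3
        · rw [← div_div] at h3
          linarith
        · rcases lt_or_ge (1 / (κ * N)) (D i).toReal with h4 | h4
          · have h5 : 1 / (N : ℝ) ≤ κ * (D i).toReal := by
              calc 1 / (N : ℝ) = κ * (1 / (κ * N)) := by field_simp
                _ ≤ _ := by gcongr
            have := min_le_right (D i).toReal (1 / (N : ℝ))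
            linarith
          · exfalso
            rcases lt_or_ge (closeWeight D (fun i => (D i).toReal) i κ)
              (κ ^ 2 / (5 * Real.log (1 / κ))) with h5 | h5
            · exact hl ⟨h3, h4, h5⟩
            · exact hg ⟨h3, h4, h5⟩
  have hsum := Finset.sum_le_sum fun i (_ : i ∈ Finset.univ) => hpt i
  simp only [Finset.sum_add_distrib, sum_uniform, ← Finset.mul_sum, sum_toReal] at hsum
  linarith

/-- The outcome of Find-Reference is correct. -/
def ReferenceCorrect [NeZero N] (D : PMF (Fin N)) (κ : ℝ) (r : Option (Fin N × ℝ)) : Prop :=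
  (r = none → 1 - tvDist D (PMF.uniformOfFintype (Fin N)) ≤ 4 * κ) ∧
    ∀ p ∈ r, 0 < (D p.1).toReal ∧ |p.2 - (D p.1).toReal| ≤ 4 * κ * (D p.1).toReal

lemma exists_of_forall₂_left {α β : Type} {R : α → β → Prop} {l : List α} {l' : List β}
    (h : List.Forall₂ R l l') {a : α} (ha : a ∈ l) : ∃ b ∈ l', R a b := by
  induction h with
  | nil => simp at ha
  | cons hab _ ih =>
    rcases List.mem_cons.1 ha with rfl | ha
    · exact ⟨_, by simp, hab⟩
    · obtain ⟨b, hb, hR⟩ := ih ha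
      exact ⟨b, by simp [hb], hR⟩

theorem guarantee_findReference [NeZero N] {c : ThetaConsts} (hc : 1024 ≤ c.cmp)
    (hc' : 2048 ≤ c.nbhd) (hcand : c.cand = 5) (hc'' : 286720 ≤ c.unif) (D : PMF (Fin N)) {κ : ℝ}
    (hκ0 : 0 < κ) (hκ : κ ≤ 1 / 8) :
    Guarantee D (findReference c κ) (ReferenceCorrect D κ) (1 / 10) := by
  classical
  unfold findReference
  have hL := two_le_log_inv hκ0 hκ
  have hL' := log_inv_le hκ0
  set L := Real.log (1 / κ)
  rw [hcand]
  set r : ℝ := 5 * (L / κ ^ 2) with hr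
  have hr0 : 0 < r := by positivity
  have ht : 8 ≤ 1 / κ := by rw [le_div_iff₀ hκ0]; linarith
  have hn : 0 < ⌈r⌉₊ := Nat.ceil_pos.2 hr0
  have hs : 160 * (⌈r⌉₊ : ℝ) ≤ (1 / κ) ^ 7 := by
    have h1 : (⌈r⌉₊ : ℝ) ≤ r + 1 := (Nat.ceil_lt_add_one hr0.le).le
    have h2 : r = 5 * (L * (1 / κ) ^ 2) := by rw [hr, one_div_pow]; ring
    set t := 1 / κ
    have h3 : r ≤ 5 * t ^ 3 := by
      rw [h2, pow_succ t 2, mul_comm L]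
      gcongr
    have h4 : 1 ≤ t ^ 3 := one_le_pow₀ (by linarith)
    have h5 : (8 : ℝ) ^ 4 ≤ t ^ 4 := by gcongr
    calc 160 * (⌈r⌉₊ : ℝ) ≤ 960 * t ^ 3 := by linarith
      _ ≤ t ^ 4 * t ^ 3 := by gcongr; linarith
      _ = t ^ 7 := by ring
  have hhit : Guarantee D (repeatAlg drawSamp ⌈r⌉₊) (fun X =>
      4 * κ ≤ 1 - tvDist D (PMF.uniformOfFintype (Fin N)) → ∃ x ∈ X, GoodReference D κ x)
      (1 / 40) := by
    set g := ∑ i, (if GoodReference D κ i then (D i).toReal else 0) with hg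
    by_cases hD : 4 * κ ≤ 1 - tvDist D (PMF.uniformOfFintype (Fin N))
    · have hκg : κ ≤ g := le_sum_goodReference D hκ0 hκ hD
      have hexp : 2 * Real.exp (-((⌈r⌉₊ : ℝ) * ((1 / 2) ^ 2 * g) / 4)) ≤ 1 / 40 := by
        have h1 : (5 : ℝ) ≤ (⌈r⌉₊ : ℝ) * ((1 / 2) ^ 2 * g) / 4 := by
          calc (5 : ℝ) = 5 * 2 * 8 / 16 := by norm_num
            _ ≤ 5 * L * (1 / κ) / 16 := by gcongr
            _ = r * ((1 / 2) ^ 2 * κ) / 4 := by rw [hr]; field_simp; norm_num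
            _ ≤ _ := by gcongr; exact Nat.le_ceil r
        have h2 : (80 : ℝ) ≤ Real.exp 5 := by
          have h3 : Real.exp 5 = Real.exp 1 ^ 5 := by rw [← Real.exp_nat_mul]; norm_num
          rw [h3]
          calc (80 : ℝ) ≤ 2.5 ^ 5 := by norm_num
            _ ≤ _ := by
                gcongr
                linarith [Real.exp_one_gt_d9]
        have h3 : Real.exp (-((⌈r⌉₊ : ℝ) * ((1 / 2) ^ 2 * g) / 4)) ≤ 1 / 80 := by
          rw [Real.exp_neg, ← one_div]
          exact one_div_le_one_div_of_le (by norm_num) (h2.trans (Real.exp_le_exp.2 h1))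
        linarith
      -- Chernoff serves only to hit a good point: a frequency within g/2 of g > 0 is not zero.
      refine ((hasLaw_drawSamp D).guarantee_frac (GoodReference D κ) hg.symm le_rfl
        (by norm_num : (0 : ℝ) < 1 / 2) (by norm_num) hn hexp).mono (fun X hX _ => ?_) le_rfl
      by_contra! hne
      have : X.filter (GoodReference D κ ·) = [] := by simpa using hne
      rw [this, List.length_nil, Nat.cast_zero, zero_div, zero_sub, abs_neg,
        abs_of_nonneg (by linarith)] at hX
      linarith
    · have h1 := (guarantee_drawSamp_pos D).repeatAlg ⌈r⌉₊
      refine h1.mono (fun X _ h => (hD h).elim) (by norm_num)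
  have hpos := (guarantee_drawSamp_pos D).repeatAlg ⌈r⌉₊
  refine (((hpos.and hhit).mono_of_always (always_repeatAlg _ _)
    (fun X hX h => And.intro hX h) le_rfl).bind (δ₂ := 3 / 40 + 0) (fun X hX => ?_)
      (by norm_num)).mono (fun _ h => h) (by norm_num)
  obtain ⟨hlen, hXpos, hXgood⟩ := hX
  have hlen0 : 0 < X.length := by omega
  have hmap := guarantee_mapAlg (f := examineCandidate c κ X.length) (R := CandidateCorrect D κ)
    (by positivity : 0 ≤ 3 / (40 * (X.length : ℝ))) (l := X) fun x hx =>
      guarantee_examineCandidate hc hc' hc'' (hXpos x hx) hκ0 hκ hlen0 (by rwa [hlen])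
  have hδ : (X.length : ℝ) * (3 / (40 * (X.length : ℝ))) = 3 / 40 := by field_simp
  rw [hδ] at hmap
  refine hmap.bind (fun l hl => ?_) le_rfl
  refine guarantee_pure D ⟨fun hnone => ?_, fun p hp => ?_⟩
  · by_contra! hD
    obtain ⟨x, hx, hg⟩ := hXgood hD.le
    obtain ⟨o, ho, hR⟩ := exists_of_forall₂_left hl hx
    exact hR.2 hg (List.findSome?_eq_none_iff.1 hnone o ho)
  · obtain ⟨o, ho, hop⟩ := List.exists_of_findSome?_eq_some hp
    obtain ⟨x, hx, hR⟩ := exists_of_forall₂_left hl.flip ho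
    obtain ⟨h1, h2⟩ := hR.1 p hop
    rw [h1]
    exact ⟨hXpos x hx, h2⟩

/-! ### Accuracy of the main algorithm. -/

/-- The two terms of K make Low imply N·D(y) ≤ ε and High imply N·D(y) ≥ 1. For a value, the errors
of ρ and d combine to a relative error 5ε/4 of ρd against D(y). -/
lemma abs_psiHat_sub_le [NeZero N] {D : PMF (Fin N)} {x y : Fin N} {ε d : ℝ} {r : CompareResult}
    (hε0 : 0 < ε) (hε : ε ≤ 1) (hx : 0 < (D x).toReal)
    (hd : |d - (D x).toReal| ≤ ε / 2 * (D x).toReal)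
    (hr : CompareCorrect D x y (ε / 2) (max ((2 / N) / d) (d / (ε / (4 * N)))) r) :
    |psiHat N ε d r - max 0 (1 - N * (D y).toReal)| ≤ 5 * ε := by
  have hN : (0 : ℝ) < N := by exact_mod_cast Nat.pos_of_ne_zero (NeZero.ne N)
  have hb : 0 ≤ (D y).toReal := ENNReal.toReal_nonneg
  cases r with
  | low =>
    change _ * (D y).toReal < (D x).toReal at hr
    simp only [psiHat]
    set a := (D x).toReal
    set b := (D y).toReal
    obtain ⟨hd1, hd2⟩ := abs_le.1 hd
    have hεa : ε * a ≤ a := mul_le_of_le_one_left hx.le hε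
    have h1 : d / (ε / (4 * N)) * b < a :=
      (mul_le_mul_of_nonneg_right (le_max_right _ _) hb).trans_lt hr
    have h2 : d * (4 * (N * b)) < ε * a := by
      rw [div_mul_eq_mul_div, div_lt_iff₀ (by positivity), ← mul_div_assoc,
        lt_div_iff₀ (by positivity)] at h1
      linarith
    have h3 : a / 2 * (4 * (N * b)) ≤ d * (4 * (N * b)) := by gcongr; linarith
    have h4 : N * b ≤ ε := by
      have : N * b * a ≤ ε * a := by
        have : 0 ≤ N * b * a := by positivity
        linarith
      exact le_of_mul_le_mul_right this hx
    have h5 : 0 ≤ N * b := by positivity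
    rw [max_eq_right (by linarith), abs_le]
    constructor <;> linarith
  | high =>
    change _ * (D x).toReal < (D y).toReal at hr
    simp only [psiHat]
    set a := (D x).toReal
    set b := (D y).toReal
    obtain ⟨hd1, hd2⟩ := abs_le.1 hd
    have hεa : ε * a ≤ a := mul_le_of_le_one_left hx.le hε
    have hd0 : 0 < d := by linarith
    have h1 : (2 / N) / d * a < b :=
      (mul_le_mul_of_nonneg_right (le_max_left _ _) hx.le).trans_lt hr
    rw [div_div, div_mul_eq_mul_div, div_lt_iff₀ (by positivity)] at h1
    have h2 : b * (N * d) ≤ b * (N * (2 * a)) := by gcongr; linarith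
    have h3 : 1 ≤ N * b := by
      refine le_of_mul_le_mul_right (a := 2 * a) ?_ (by positivity)
      linarith
    rw [max_eq_left (by linarith)]
    simp only [sub_self, abs_zero]
    positivity
  | value ρ =>
    have hr' : |ρ * (D x).toReal - (D y).toReal| ≤ ε / 2 * (D y).toReal := hr
    simp only [psiHat]
    set a := (D x).toReal
    set b := (D y).toReal
    obtain ⟨hd1, hd2⟩ := abs_le.1 hd
    obtain ⟨hr1, hr2⟩ := abs_le.1 hr'
    have hεa : ε * a ≤ a := mul_le_of_le_one_left hx.le hε
    have hεb : ε * b ≤ b := mul_le_of_le_one_left hb hε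
    have hρ0 : 0 ≤ ρ := by
      by_contra! h
      have := mul_neg_of_neg_of_pos h hx
      linarith
    have h1 : |ρ * d - b| ≤ 5 / 4 * ε * b := by
      have h2 : |ρ * (d - a)| ≤ ε / 2 * (ρ * a) := by
        rw [abs_mul, abs_of_nonneg hρ0]
        calc ρ * |d - a| ≤ ρ * (ε / 2 * a) := by gcongr
          _ = _ := by ring
      have h3 : ε / 2 * (ρ * a) ≤ ε / 2 * (3 / 2 * b) :=
        mul_le_mul_of_nonneg_left (by linarith) (by positivity)
      calc |ρ * d - b| = |ρ * (d - a) + (ρ * a - b)| := by ring_nf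
        _ ≤ |ρ * (d - a)| + |ρ * a - b| := abs_add_le _ _
        _ ≤ _ := by linarith
    obtain ⟨h1a, h1b⟩ := abs_le.1 h1
    have hlow : b ≤ 4 * (ρ * d) := by
      have h2 : ρ * (a / 2) ≤ ρ * d := by gcongr; linarith
      linarith
    have hNb : 0 ≤ N * b := by positivity
    have hNa : N * (ρ * d) ≤ N * b + 5 / 4 * ε * (N * b) := by
      calc N * (ρ * d) ≤ N * (b + 5 / 4 * ε * b) := by gcongr; linarith
        _ = _ := by ring
    have hNc : N * b - 5 / 4 * ε * (N * b) ≤ N * (ρ * d) := by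
      calc _ = N * (b - 5 / 4 * ε * b) := by ring
        _ ≤ _ := by gcongr; linarith
    have hNd : N * b ≤ 4 * (N * (ρ * d)) := by
      calc N * b ≤ N * (4 * (ρ * d)) := by gcongr
        _ = _ := by ring
    split_ifs with h2 h3
    · rw [div_le_iff₀ hN] at h2
      rcases le_total 1 (N * b) with h | h
      · rw [max_eq_left (by linarith)]
        simp only [sub_self, abs_zero]
        positivity
      · have : ε * (N * b) ≤ ε := mul_le_of_le_one_right hε0.le h
        rw [max_eq_right (by linarith), abs_le]
        constructor <;> linarith
    · rw [le_div_iff₀ (by positivity)] at h3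
      rw [max_eq_right (by linarith), abs_le]
      constructor <;> linarith
    · rw [not_le, lt_div_iff₀ hN] at h2
      -- Here N·ρ·d < 1, so N·D(y) < 4 and the relative error 5ε/4 becomes the absolute error 5ε.
      have h4 : ε * (N * b) ≤ ε * 4 := by gcongr; linarith
      rcases le_total 1 (N * b) with h | h
      · rw [max_eq_left (by linarith), abs_le]
        constructor <;> linarith
      · rw [max_eq_right (by linarith), abs_le]
        constructor <;> linarith

lemma sum_max_zero_eq_tvDist_uniform [NeZero N] (D : PMF (Fin N)) :
    ∑ i, 1 / (N : ℝ) * max 0 (1 - N * (D i).toReal) =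
      tvDist D (PMF.uniformOfFintype (Fin N)) := by
  have hN : (0 : ℝ) < N := by exact_mod_cast Nat.pos_of_ne_zero (NeZero.ne N)
  have h : ∀ i, 1 / (N : ℝ) * max 0 (1 - N * (D i).toReal) =
      1 / N - min (D i).toReal (1 / (N : ℝ)) := fun i => by
    have h1 : (N : ℝ) * (1 / N) = 1 := mul_one_div_cancel hN.ne'
    have h2 : 1 / (N : ℝ) * (1 - N * (D i).toReal) = 1 / N - (D i).toReal := by field_simp
    rcases le_total (D i).toReal (1 / (N : ℝ)) with h | h
    · have := mul_le_mul_of_nonneg_left h hN.le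
      rw [min_eq_left h, max_eq_right (by linarith), h2]
    · have := mul_le_mul_of_nonneg_left h hN.le
      rw [min_eq_right h, max_eq_left (by linarith)]
      ring
  simp only [h, Finset.sum_sub_distrib, sum_uniform, ← one_sub_tvDist_uniform]
  ring

lemma abs_sum_sub_sum_map_le {α : Type} {ψ : α → ℝ} {e : ℝ} {S : List α} {l : List ℝ}
    (h : List.Forall₂ (fun y v => |v - ψ y| ≤ e) S l) :
    |l.sum - (S.map ψ).sum| ≤ S.length * e := by
  induction h with
  | nil => simp
  | @cons y v S l hyv _ ih =>
    simp only [List.sum_cons, List.map_cons, List.length_cons]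
    push_cast
    calc |v + l.sum - (ψ y + (S.map ψ).sum)| = |(v - ψ y) + (l.sum - (S.map ψ).sum)| := by ring_nf
      _ ≤ |v - ψ y| + |l.sum - (S.map ψ).sum| := abs_add_le _ _
      _ ≤ _ := by linarith

theorem guarantee_estimateDistUnif [NeZero N] {c : ThetaConsts} (hc : 1024 ≤ c.cmp)
    (hc' : 2048 ≤ c.nbhd) (hcand : c.cand = 5) (hc'' : 286720 ≤ c.unif) (hmain : 16 ≤ c.main)
    (D : PMF (Fin N)) {ε : ℝ} (hε0 : 0 < ε) (hε : ε ≤ 1) :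
    Guarantee D (estimateDistUnif c N ε)
      (fun d => |d - tvDist D (PMF.uniformOfFintype (Fin N))| ≤ 6 * ε) (3 / 10) := by
  have hN : (0 : ℝ) < N := by exact_mod_cast Nat.pos_of_ne_zero (NeZero.ne N)
  unfold estimateDistUnif
  refine ((guarantee_findReference hc hc' hcand hc'' D (by positivity : 0 < ε / 8)
    (by linarith)).bind (δ₂ := 1 / 10 + (1 / 10 + 0)) (fun o ho => ?_) (by norm_num)).mono
    (fun _ h => h) (by norm_num)
  set tv := tvDist D (PMF.uniformOfFintype (Fin N)) with htv
  match o, ho with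
  | none, ho =>
    have h1 := ho.1 rfl
    have h2 : 0 ≤ 1 - tv := by
      rw [htv, one_sub_tvDist_uniform]
      exact Finset.sum_nonneg fun i _ => le_min ENNReal.toReal_nonneg (by positivity)
    refine (guarantee_pure D (a := (1 : ℝ)) ?_).mono (fun _ h => h) (by norm_num)
    rw [abs_of_nonneg h2]
    linarith
  | some (x, d), ho =>
    obtain ⟨hx, hd⟩ := ho.2 (x, d) rfl
    simp only at hx hd ⊢
    have hd' : |d - (D x).toReal| ≤ ε / 2 * (D x).toReal := by
      refine hd.trans (le_of_eq (by ring))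
    have hd0 : 0 < d := by
      have : ε * (D x).toReal ≤ (D x).toReal := mul_le_of_le_one_left hx.le hε
      linarith [(abs_le.1 hd').1]
    set K : ℝ := max ((2 / N) / d) (d / (ε / (4 * N))) with hK
    -- If d ≤ 2/N the first term is at least 1, and otherwise the second, because ε/(4N) ≤ 2/N.
    have hK1 : 1 ≤ K := by
      rcases le_total d (2 / N) with h | h
      · exact le_max_of_le_left ((one_le_div hd0).2 h)
      · refine le_max_of_le_right ((one_le_div (by positivity)).2 (le_trans ?_ h))
        rw [div_le_div_iff₀ (by positivity) hN]
        nlinarith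
    set r : ℝ := c.main * (1 / ε ^ 2) with hr
    have hr0 : 0 < r := mul_pos c.main_pos (by positivity)
    set ψ : Fin N → ℝ := fun i => max 0 (1 - N * (D i).toReal) with hψ
    have hexp : 2 * Real.exp (-((⌈r⌉₊ : ℝ) * (ε ^ 2 * 1) / 4)) ≤ 1 / 10 := by
      have h1 : (4 : ℝ) ≤ (⌈r⌉₊ : ℝ) * (ε ^ 2 * 1) / 4 := by
        calc (4 : ℝ) ≤ c.main / 4 := by linarith
          _ = r * (ε ^ 2 * 1) / 4 := by rw [hr]; field_simp
          _ ≤ _ := by gcongr; exact Nat.le_ceil r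
      have h2 : (20 : ℝ) ≤ Real.exp 4 := by
        have h3 : Real.exp 4 = Real.exp 1 ^ 4 := by rw [← Real.exp_nat_mul]; norm_num
        rw [h3]
        calc (20 : ℝ) ≤ 2.5 ^ 4 := by norm_num
          _ ≤ _ := by
              gcongr
              linarith [Real.exp_one_gt_d9]
      have h3 : Real.exp (-((⌈r⌉₊ : ℝ) * (ε ^ 2 * 1) / 4)) ≤ 1 / 20 := by
        rw [Real.exp_neg, ← one_div]
        exact one_div_le_one_div_of_le (by norm_num) (h2.trans (Real.exp_le_exp.2 h1))
      linarith
    have hconc := (hasLaw_drawUniform D).guarantee_abs_sub_le (f := ψ)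
      (fun i => le_max_left _ _) (fun i => max_le zero_le_one (by
        have : 0 ≤ N * (D i).toReal := by positivity
        linarith)) (sum_max_zero_eq_tvDist_uniform D) (q := 1) (by
          rw [← sub_nonneg, one_sub_tvDist_uniform]
          exact Finset.sum_nonneg fun i _ => le_min ENNReal.toReal_nonneg (by positivity))
      hε0 (by linarith) ⌈r⌉₊
    refine Guarantee.bind (hconc.mono_of_always (always_repeatAlg _ _)
      (fun l hl h => And.intro hl h) hexp) (fun S hS => ?_) (by norm_num)
    obtain ⟨hlen, hS⟩ := hS
    have hlen1 : (1 : ℝ) ≤ S.length := by rw [hlen]; exact_mod_cast Nat.ceil_pos.2 hr0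
    have hδ : 1 / (10 * (S.length : ℝ)) ≤ 1 / 2 := by
      rw [div_le_div_iff₀ (by positivity) two_pos]; linarith
    have hpoint : ∀ y ∈ S, Guarantee D (do
        let r ← compareAlg c x y (ε / 2) K (1 / (10 * (S.length : ℝ)))
        return psiHat N ε d r) (fun v => |v - ψ y| ≤ 5 * ε) (1 / (10 * (S.length : ℝ))) := by
      intro y _
      refine ((guarantee_compareAlg hc (y := y) hx (by positivity : 0 < ε / 2) (by linarith) hK1
        (by positivity : 0 < 1 / (10 * (S.length : ℝ))) hδ).bind (δ₂ := 0) (fun r hr => ?_)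
          le_rfl).mono (fun _ h => h) (add_zero _).le
      exact guarantee_pure D (abs_psiHat_sub_le hε0 hε hx hd' hr)
    have hmap := guarantee_mapAlg (R := fun y v => |v - ψ y| ≤ 5 * ε)
      (by positivity : 0 ≤ 1 / (10 * (S.length : ℝ))) hpoint
    have hδ' : (S.length : ℝ) * (1 / (10 * (S.length : ℝ))) = 1 / 10 := by field_simp
    rw [hδ'] at hmap
    refine hmap.bind (fun l hl => guarantee_pure D ?_) le_rfl
    have h1 := abs_sum_sub_sum_map_le hl
    rw [← hlen] at hS
    have hlen0 : (0 : ℝ) < S.length := by linarith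
    have h2 : 1 / (S.length : ℝ) * l.sum - tv =
        ((l.sum - (S.map ψ).sum) + ((S.map ψ).sum - S.length * tv)) / S.length := by
      field_simp
      ring
    rw [h2, abs_div, abs_of_pos hlen0, div_le_iff₀ hlen0]
    refine (abs_add_le _ _).trans ?_
    linarith

/-! ### Worst-case query counts. -/

/-- The number of queries of one call of Compare. -/
noncomputable def compareQueries (c : ThetaConsts) (η K δ : ℝ) : ℕ :=
  ⌈c.cmp * (K * Real.log (1 / δ) / η ^ 2)⌉₊

lemma compareQueries_mono (c : ThetaConsts) {η K K' δ : ℝ} (hK : K ≤ K')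
    (hδ : 0 ≤ Real.log (1 / δ)) : compareQueries c η K δ ≤ compareQueries c η K' δ := by
  have := c.cmp_pos
  unfold compareQueries
  gcongr

lemma queries_compareAlg_le (c : ThetaConsts) (x y : Fin N) (η K δ : ℝ) :
    (compareAlg c x y η K δ).queries ≤ compareQueries c η K δ := by
  unfold compareAlg
  split_ifs with hxy
  · refine (queries_bind_le' (b := 0) fun l => ?_).trans ?_
    · simp only
      split_ifs <;> exact le_rfl
    · refine (queries_repeatAlg_le _ _).trans (le_of_eq_of_le ?_ (mul_one _).le)
      simp only [compareQueries, queries]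
      congr 1
      rw [Finset.sup_const ⟨x, Finset.mem_univ x⟩]
      rfl
  · exact Nat.zero_le _

lemma queries_closePoints_le (c : ThetaConsts) (x : Fin N) (θ α δ : ℝ) (l : List (Fin N)) :
    (closePoints c x θ α δ l).queries ≤ l.length * compareQueries c (θ / 4) 4 δ :=
  queries_filterAlg_le (fun y =>
    (queries_bind_le' (b := 0) fun _ => le_rfl).trans (queries_compareAlg_le c x y _ _ _)) l

lemma queries_drawSamp_le : (drawSamp : QueryAlg N (Fin N)).queries ≤ 1 := by
  simp only [drawSamp, queries]
  exact Nat.add_le_add_left (Finset.sup_le fun _ _ => le_rfl) 1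

lemma queries_drawUniform [NeZero N] : (drawUniform : QueryAlg N (Fin N)).queries ≤ 0 :=
  Finset.sup_le fun _ _ => le_rfl

lemma queries_drawBelow (r : ℝ) : (drawBelow r : QueryAlg N ℕ).queries ≤ 0 := by
  unfold drawBelow
  split_ifs
  · exact le_rfl
  · exact Finset.sup_le fun _ _ => le_rfl

lemma queries_repeat_drawSamp_le (n : ℕ) :
    (repeatAlg (drawSamp : QueryAlg N (Fin N)) n).queries ≤ n :=
  (queries_repeatAlg_le _ _).trans ((Nat.mul_le_mul_left n queries_drawSamp_le).trans (mul_one n).le)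

lemma queries_repeat_drawUniform_le [NeZero N] (n : ℕ) :
    (repeatAlg (drawUniform : QueryAlg N (Fin N)) n).queries ≤ 0 :=
  (queries_repeatAlg_le _ _).trans (Nat.mul_le_mul_left n queries_drawUniform)

/-- The sample size in Estimate-Neighborhood. -/
noncomputable def neighborhoodSamples (c : ThetaConsts) (β η δ : ℝ) : ℕ :=
  ⌈c.nbhd * (Real.log (1 / δ) / (β * η ^ 2))⌉₊

lemma queries_estimateNeighborhood_le (c : ThetaConsts) (x : Fin N) (κ β η δ : ℝ) {n : ℕ}
    (hn : neighborhoodSamples c β η δ = n) :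
    (estimateNeighborhood c x κ β η δ).queries ≤
      n + n * compareQueries c (thetaOf κ β η δ / 4) 4 (δ / (4 * n)) := by
  subst hn
  unfold estimateNeighborhood
  simp only
  refine (queries_bind_le' fun i => ?_).trans ((Nat.add_le_add_right (queries_drawBelow _) _).trans
    (Nat.zero_add _).le)
  refine (queries_bind_le (always_repeatAlg _ _) fun S hS => ?_).trans
    (Nat.add_le_add_right (queries_repeat_drawSamp_le _) _)
  refine (queries_bind_le' (b := 0) fun T => le_rfl).trans
    ((queries_closePoints_le _ _ _ _ _ _).trans ?_)
  change S.length = neighborhoodSamples c β η δ at hS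
  rw [hS]
  exact Nat.mul_le_mul_right _ (hS ▸ (List.dedup_sublist S).length_le)

/-- The number of uniform points per candidate. -/
noncomputable def uniformSamples (c : ThetaConsts) (κ : ℝ) : ℕ :=
  ⌈c.unif * (Real.log (1 / κ) ^ 2 / κ ^ 5)⌉₊

lemma queries_examineCandidate_le [NeZero N] (c : ThetaConsts) (κ : ℝ) (s : ℕ) (x : Fin N)
    {β δ θ : ℝ} {n m : ℕ} (hβ : κ ^ 2 / (40 * Real.log (1 / κ)) = β) (hδ : 1 / (40 * (s : ℝ)) = δ)
    (hθ : thetaOf κ β κ δ = θ) (hn : neighborhoodSamples c β κ δ = n)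
    (hm : uniformSamples c κ = m) :
    (examineCandidate c κ s x).queries ≤
      n + n * compareQueries c (θ / 4) 4 (δ / (4 * n)) +
        m * compareQueries c (θ / 4) 4 (1 / (40 * (s : ℝ) * m)) := by
  subst hm
  unfold examineCandidate
  simp only [hβ, hδ, hθ]
  refine (queries_bind_le' fun r => ?_).trans (Nat.add_le_add_right
    (hθ ▸ queries_estimateNeighborhood_le c x κ β κ δ hn) _)
  obtain ⟨w, α⟩ := r
  simp only
  split_ifs
  · exact Nat.zero_le _
  · refine (queries_bind_le (always_repeatAlg _ _) fun Y hY => ?_).trans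
      ((Nat.add_le_add_right (queries_repeat_drawUniform_le _) _).trans (Nat.zero_add _).le)
    refine (queries_bind_le' (b := 0) fun T => ?_).trans
      ((queries_closePoints_le _ _ _ _ _ _).trans ?_)
    · split_ifs <;> exact le_rfl
    · change Y.length = uniformSamples c κ at hY
      rw [hY]

/-- The number of candidates in Find-Reference. -/
noncomputable def candidateSamples (c : ThetaConsts) (κ : ℝ) : ℕ :=
  ⌈c.cand * (Real.log (1 / κ) / κ ^ 2)⌉₊

lemma queries_findReference_le [NeZero N] (c : ThetaConsts) (κ : ℝ) {β δ θ : ℝ} {s n m : ℕ}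
    (hs : candidateSamples c κ = s)
    (hβ : κ ^ 2 / (40 * Real.log (1 / κ)) = β) (hδ : 1 / (40 * (s : ℝ)) = δ)
    (hθ : thetaOf κ β κ δ = θ) (hn : neighborhoodSamples c β κ δ = n)
    (hm : uniformSamples c κ = m) :
    (findReference c κ : QueryAlg N _).queries ≤
      s + s * (n + n * compareQueries c (θ / 4) 4 (δ / (4 * n)) +
        m * compareQueries c (θ / 4) 4 (1 / (40 * (s : ℝ) * m))) := by
  subst hs
  unfold findReference
  refine (queries_bind_le (always_repeatAlg _ _) fun X hX => ?_).trans
    (Nat.add_le_add_right (queries_repeat_drawSamp_le _) _)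
  change X.length = candidateSamples c κ at hX
  refine (queries_bind_le' (b := 0) fun T => le_rfl).trans ?_
  rw [hX]
  exact (queries_mapAlg_le (fun x => queries_examineCandidate_le c κ _ x hβ hδ hθ hn hm) X).trans
    (by rw [hX])

lemma always_mapAlg {α β : Type} {f : α → QueryAlg N β} {P : β → Prop}
    (hf : ∀ a, (f a).Always P) (l : List α) : (mapAlg f l).Always fun l' => ∀ b ∈ l', P b := by
  induction l with
  | nil => exact fun b hb => by simp at hb
  | cons a l ih =>
    refine (hf a).bind fun b hb => ih.bind fun l' hl' => ?_
    change ∀ b' ∈ b :: l', P b'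
    simpa using ⟨hb, hl'⟩

/-- The weight estimate of an accepted reference point is in the prescribed range. -/
def WeightInRange (N : ℕ) (κ : ℝ) (r : Option (Fin N × ℝ)) : Prop :=
  ∀ p ∈ r, κ / (4 * N) ≤ p.2 ∧ p.2 ≤ 2 / (κ * N)

/-- The query bound concerns every path, including those with wrong estimates, so K must be bounded
deterministically. The range test at acceptance provides this. -/
lemma always_examineCandidate [NeZero N] (c : ThetaConsts) (κ : ℝ) (s : ℕ) (x : Fin N) :
    (examineCandidate c κ s x).Always (WeightInRange N κ) := by
  have htriv : ∀ {γ : Type} (A : QueryAlg N γ), A.Always fun _ => True :=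
    fun A => always_of_forall (fun _ => trivial) A
  have hnone : (pure none : QueryAlg N (Option (Fin N × ℝ))).Always (WeightInRange N κ) :=
    fun p hp => by simp at hp
  unfold examineCandidate
  simp only
  refine (htriv _).bind fun r _ => ?_
  obtain ⟨w, α⟩ := r
  simp only
  split_ifs
  · exact hnone
  · refine (htriv _).bind fun Y _ => (htriv _).bind fun T _ => ?_
    split_ifs with h
    · intro p hp
      rw [Option.mem_some_iff] at hp
      subst hp
      exact h.2
    · exact hnone

lemma always_findReference [NeZero N] (c : ThetaConsts) (κ : ℝ) :
    (findReference c κ).Always (WeightInRange N κ) := by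
  refine (always_repeatAlg _ _).bind fun X _ =>
    (always_mapAlg (always_examineCandidate c κ X.length) X).bind fun l hl p hp => ?_
  obtain ⟨o, ho, hop⟩ := List.exists_of_findSome?_eq_some hp
  exact hl o ho p hop

/-- The number of uniform points in the main algorithm. -/
noncomputable def mainSamples (c : ThetaConsts) (ε : ℝ) : ℕ := ⌈c.main * (1 / ε ^ 2)⌉₊

lemma queries_estimateDistUnif_le [NeZero N] (c : ThetaConsts) {ε : ℝ} (hε0 : 0 < ε) (hε : ε ≤ 1) :
    (estimateDistUnif c N ε).queries ≤ (findReference c (ε / 8) : QueryAlg N _).queries +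
      mainSamples c ε *
        compareQueries c (ε / 2) (64 / ε ^ 2) (1 / (10 * (mainSamples c ε : ℝ))) := by
  have hN : (0 : ℝ) < N := by exact_mod_cast Nat.pos_of_ne_zero (NeZero.ne N)
  unfold estimateDistUnif
  refine queries_bind_le (always_findReference c (ε / 8)) fun o ho => ?_
  match o, ho with
  | none, ho => exact Nat.zero_le _
  | some (x, d), ho =>
    obtain ⟨h1, h2⟩ := ho (x, d) rfl
    simp only at h1 h2 ⊢
    have hd0 : 0 < d := lt_of_lt_of_le (by positivity) h1
    rw [div_le_iff₀ (by positivity)] at h1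
    rw [le_div_iff₀ (by positivity)] at h2
    have hε2 : 1 ≤ 1 / ε := (one_le_div hε0).2 hε
    -- With κ = ε/8, the range of d bounds the two terms by 8/κ = 64/ε and 8/(κε) = 64/ε².
    have hK : max ((2 / N) / d) (d / (ε / (4 * N))) ≤ 64 / ε ^ 2 := by
      refine max_le ?_ ?_
      · rw [div_div, div_le_div_iff₀ (by positivity) (by positivity)]
        have : ε ^ 2 ≤ ε := by nlinarith
        linarith
      · rw [← div_mul, div_mul_eq_mul_div, div_le_div_iff₀ hε0 (by positivity)]
        have : d * (4 * N) * ε ^ 2 = 32 * (d * (ε / 8 * N)) * ε := by ring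
        rw [this]
        gcongr
        linarith
    refine (queries_bind_le (always_repeatAlg _ _) fun S hS => ?_).trans
      ((Nat.add_le_add_right (queries_repeat_drawUniform_le _) _).trans (Nat.zero_add _).le)
    change S.length = mainSamples c ε at hS
    have hM : (1 : ℝ) ≤ mainSamples c ε := by
      have : 0 < mainSamples c ε := Nat.ceil_pos.2 (mul_pos c.main_pos (by positivity))
      exact_mod_cast this
    refine (queries_bind_le' (b := 0) fun T => le_rfl).trans
      ((queries_mapAlg_le (fun y => (queries_bind_le' (b := 0) fun _ => le_rfl).trans
        ((queries_compareAlg_le c x y _ _ _).trans (compareQueries_mono c hK ?_))) S).trans ?_)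
    · rw [hS, one_div_one_div]
      exact Real.log_nonneg (by linarith)
    · rw [hS]

/-! ### Calculus of polynomial growth up to logarithms. -/

/-- On `(0, 1/8]`, the function `f` is nonnegative and at most `(1/κ)^b` up to a constant and powers
of `log (1/κ)`. -/
def PolyBound (b : ℕ) (f : ℝ → ℝ) : Prop :=
  ∃ (C : ℝ) (a : ℕ), ∀ κ, 0 < κ → κ ≤ 1 / 8 →
    0 ≤ f κ ∧ f κ ≤ C * ((1 / κ) ^ b * Real.log (1 / κ) ^ a)

namespace PolyBound

variable {b b' : ℕ} {f g : ℝ → ℝ}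

lemma exists_nonneg (h : PolyBound b f) : ∃ (C : ℝ) (a : ℕ), 0 ≤ C ∧ ∀ κ, 0 < κ → κ ≤ 1 / 8 →
    0 ≤ f κ ∧ f κ ≤ C * ((1 / κ) ^ b * Real.log (1 / κ) ^ a) := by
  obtain ⟨C, a, h⟩ := h
  refine ⟨|C|, a, abs_nonneg C, fun κ h0 h1 => ⟨(h κ h0 h1).1, (h κ h0 h1).2.trans ?_⟩⟩
  have := two_le_log_inv h0 h1
  gcongr
  exact le_abs_self C

lemma mono (h : PolyBound b f) (hg : ∀ κ, 0 < κ → κ ≤ 1 / 8 → 0 ≤ g κ ∧ g κ ≤ f κ) :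
    PolyBound b g := by
  obtain ⟨C, a, h⟩ := h
  exact ⟨C, a, fun κ h0 h1 => ⟨(hg κ h0 h1).1, (hg κ h0 h1).2.trans (h κ h0 h1).2⟩⟩

lemma congr (h : PolyBound b f) (hg : ∀ κ, 0 < κ → κ ≤ 1 / 8 → g κ = f κ) : PolyBound b g := by
  obtain ⟨C, a, h⟩ := h
  exact ⟨C, a, fun κ h0 h1 => by rw [hg κ h0 h1]; exact h κ h0 h1⟩

lemma of_le (h : PolyBound b f) (hb : b ≤ b') : PolyBound b' f := by
  obtain ⟨C, a, hC, h⟩ := h.exists_nonneg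
  refine ⟨C, a, fun κ h0 h1 => ⟨(h κ h0 h1).1, (h κ h0 h1).2.trans ?_⟩⟩
  have := two_le_log_inv h0 h1
  have : 1 ≤ 1 / κ := (one_le_div h0).2 (by linarith)
  gcongr

lemma const {c : ℝ} (hc : 0 ≤ c) : PolyBound 0 fun _ => c :=
  ⟨c, 0, fun κ _ _ => ⟨hc, by simp⟩⟩

lemma inv_pow (b : ℕ) : PolyBound b fun κ => (1 / κ) ^ b :=
  ⟨1, 0, fun κ h0 _ => ⟨by positivity, by simp⟩⟩

lemma log_inv : PolyBound 0 fun κ => Real.log (1 / κ) :=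
  ⟨1, 1, fun κ h0 h1 => ⟨by linarith [two_le_log_inv h0 h1], by simp⟩⟩

lemma mul (hf : PolyBound b f) (hg : PolyBound b' g) : PolyBound (b + b') fun κ => f κ * g κ := by
  obtain ⟨C, a, hC, hf⟩ := hf.exists_nonneg
  obtain ⟨C', a', hC', hg⟩ := hg.exists_nonneg
  refine ⟨C * C', a + a', fun κ h0 h1 => ?_⟩
  obtain ⟨hf0, hf1⟩ := hf κ h0 h1
  obtain ⟨hg0, hg1⟩ := hg κ h0 h1
  refine ⟨mul_nonneg hf0 hg0, (mul_le_mul hf1 hg1 hg0 (hf0.trans hf1)).trans (le_of_eq ?_)⟩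
  rw [pow_add, pow_add]
  ring

lemma add (hf : PolyBound b f) (hg : PolyBound b g) : PolyBound b fun κ => f κ + g κ := by
  obtain ⟨C, a, hC, hf⟩ := hf.exists_nonneg
  obtain ⟨C', a', hC', hg⟩ := hg.exists_nonneg
  refine ⟨C + C', a + a', fun κ h0 h1 => ?_⟩
  obtain ⟨hf0, hf1⟩ := hf κ h0 h1
  obtain ⟨hg0, hg1⟩ := hg κ h0 h1
  have hL := two_le_log_inv h0 h1
  refine ⟨add_nonneg hf0 hg0, ?_⟩
  rw [add_mul]
  refine add_le_add (hf1.trans ?_) (hg1.trans ?_)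
  · gcongr
    · linarith
    · omega
  · gcongr
    · linarith
    · omega

lemma pow (hf : PolyBound b f) (n : ℕ) : PolyBound (n * b) fun κ => f κ ^ n := by
  induction n with
  | zero => simpa using const zero_le_one
  | succ n ih =>
    simp only [pow_succ, add_mul, one_mul]
    exact ih.mul hf

lemma ceil (hf : PolyBound b f) : PolyBound b fun κ => (⌈f κ⌉₊ : ℝ) := by
  refine (hf.add ((const zero_le_one).of_le (Nat.zero_le b))).mono fun κ h0 h1 =>
    ⟨by positivity, ?_⟩
  obtain ⟨C, a, h⟩ := hf
  exact (Nat.ceil_lt_add_one (h κ h0 h1).1).le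

/-- The logarithm of a polynomially bounded function is O(log(1/κ)), so confidence parameters leave
exponents unchanged. -/
lemma log (hf : PolyBound b f) (h1 : ∀ κ, 0 < κ → κ ≤ 1 / 8 → 1 ≤ f κ) :
    PolyBound 0 fun κ => Real.log (f κ) := by
  obtain ⟨C, a, hC, hf⟩ := hf.exists_nonneg
  refine ⟨C + b + a, 1, fun κ h0 hκ => ⟨Real.log_nonneg (h1 κ h0 hκ), ?_⟩⟩
  have hL := two_le_log_inv h0 hκ
  have hfκ := (hf κ h0 hκ).2
  set L := Real.log (1 / κ) with hLdef
  have hpos : 0 < f κ := by linarith [h1 κ h0 hκ]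
  have hC0 : 0 < C := by
    by_contra! h
    have hC' : C = 0 := le_antisymm h hC
    rw [hC', zero_mul] at hfκ
    linarith
  have hlog := Real.log_le_log hpos hfκ
  rw [Real.log_mul hC0.ne' (by positivity), Real.log_mul (by positivity) (by positivity),
    Real.log_pow, Real.log_pow, ← hLdef] at hlog
  have h2 : Real.log C ≤ C := (Real.log_le_sub_one_of_pos hC0).trans (by linarith)
  have h3 : Real.log L ≤ L := (Real.log_le_sub_one_of_pos (by linarith)).trans (by linarith)
  have h4 : C ≤ C * L := le_mul_of_one_le_right hC (by linarith)
  have h5 : (a : ℝ) * Real.log L ≤ a * L := by gcongr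
  simp only [pow_zero, one_mul, pow_one, add_mul]
  linarith

end PolyBound

lemma polyBound_compareQueries (c : ThetaConsts) {η K δ : ℝ → ℝ} {b k d : ℕ}
    (hη : PolyBound b fun κ => 1 / η κ) (hK : PolyBound k K) (hδ : PolyBound d fun κ => 1 / δ κ)
    (hδ1 : ∀ κ, 0 < κ → κ ≤ 1 / 8 → 1 ≤ 1 / δ κ) :
    PolyBound (k + 2 * b) fun κ => (compareQueries c (η κ) (K κ) (δ κ) : ℝ) := by
  have h := ((PolyBound.const c.cmp_pos.le).mul ((hK.mul (hδ.log hδ1)).mul (hη.pow 2))).ceil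
  refine (h.congr fun κ _ _ => ?_).of_le (by omega)
  unfold compareQueries
  rw [one_div_pow, mul_one_div]

/-- Exponents of 1/κ: s and 1/δ have 2, n has 4, m has 5, 1/θ has 6, one fine Compare has 12. The
dominant term s·m·12 amounts to 2 + 5 + 12 = 19, within the allowed 20. -/
lemma polyBound_queries (c : ThetaConsts) : ∃ q : ℝ → ℝ, PolyBound 20 q ∧
    ∀ ε, 0 < ε → ε ≤ 1 → ∀ (N : ℕ) [NeZero N],
      ((estimateDistUnif c N ε).queries : ℝ) ≤ q (ε / 8) := by
  let s : ℝ → ℕ := candidateSamples c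
  let β : ℝ → ℝ := fun κ => κ ^ 2 / (40 * Real.log (1 / κ))
  let δ : ℝ → ℝ := fun κ => 1 / (40 * (s κ : ℝ))
  let θ : ℝ → ℝ := fun κ => thetaOf κ (β κ) κ (δ κ)
  let n : ℝ → ℕ := fun κ => neighborhoodSamples c (β κ) κ (δ κ)
  let m : ℝ → ℕ := uniformSamples c
  let M : ℝ → ℕ := fun κ => mainSamples c (8 * κ)
  have hL : PolyBound 0 fun κ => Real.log (1 / κ) := PolyBound.log_inv
  have hs : PolyBound 2 fun κ => (s κ : ℝ) := by
    refine (((PolyBound.const c.cand_pos.le).mul (hL.mul (PolyBound.inv_pow 2))).ceil.congr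
      fun κ _ _ => ?_)
    simp only [s, candidateSamples]
    rw [one_div_pow, mul_one_div]
  have hs1 : ∀ κ, 0 < κ → κ ≤ 1 / 8 → (1 : ℝ) ≤ s κ := fun κ h0 h1 => by
    have := two_le_log_inv h0 h1
    have : 0 < s κ := Nat.ceil_pos.2 (mul_pos c.cand_pos (by positivity))
    exact_mod_cast this
  have hδ : PolyBound 2 fun κ => 1 / δ κ :=
    (((PolyBound.const (by norm_num : (0 : ℝ) ≤ 40)).mul hs).congr fun κ _ _ => by
      simp only [δ, one_div_one_div]).of_le (by norm_num)
  have hδ1 : ∀ κ, 0 < κ → κ ≤ 1 / 8 → 1 ≤ 1 / δ κ := fun κ h0 h1 => by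
    simp only [δ, one_div_one_div]
    linarith [hs1 κ h0 h1]
  have hn : PolyBound 4 fun κ => (n κ : ℝ) := by
    refine (((PolyBound.const c.nbhd_pos.le).mul ((hδ.log hδ1).mul
      (((PolyBound.const (by norm_num : (0 : ℝ) ≤ 40)).mul hL).mul
        (PolyBound.inv_pow 4)))).ceil.congr fun κ h0 h1 => ?_)
    have := two_le_log_inv h0 h1
    simp only [n, neighborhoodSamples, β]
    congr 3
    field_simp
  have hn1 : ∀ κ, 0 < κ → κ ≤ 1 / 8 → (1 : ℝ) ≤ n κ := fun κ h0 h1 => by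
    have := two_le_log_inv h0 h1
    have hs := hs1 κ h0 h1
    have hlog : 0 < Real.log (1 / δ κ) := by
      simp only [δ, one_div_one_div]
      exact Real.log_pos (by linarith)
    have : 0 < n κ := Nat.ceil_pos.2 (mul_pos c.nbhd_pos (by
      simp only [β]
      positivity))
    exact_mod_cast this
  have hθ : PolyBound 6 fun κ => 1 / (θ κ / 4) := by
    refine ((((PolyBound.const (by norm_num : (0 : ℝ) ≤ 4 * 64 * 40)).mul hL).mul
      (PolyBound.inv_pow 4)).mul hδ).congr fun κ h0 h1 => ?_
    have := two_le_log_inv h0 h1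
    have := hs1 κ h0 h1
    simp only [θ, thetaOf, β, δ]
    field_simp
  have hm : PolyBound 5 fun κ => (m κ : ℝ) := by
    refine (((PolyBound.const c.unif_pos.le).mul ((hL.pow 2).mul
      (PolyBound.inv_pow 5))).ceil.congr fun κ _ _ => ?_)
    simp only [m, uniformSamples]
    rw [one_div_pow, mul_one_div]
  have hm1 : ∀ κ, 0 < κ → κ ≤ 1 / 8 → (1 : ℝ) ≤ m κ := fun κ h0 h1 => by
    have := two_le_log_inv h0 h1
    have : 0 < m κ := Nat.ceil_pos.2 (mul_pos c.unif_pos (by positivity))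
    exact_mod_cast this
  have hM : PolyBound 2 fun κ => (M κ : ℝ) := by
    refine ((PolyBound.const c.main_pos.le).mul ((PolyBound.const
      (by norm_num : (0 : ℝ) ≤ 1 / 64)).mul (PolyBound.inv_pow 2))).ceil.congr fun κ h0 _ => ?_
    simp only [M, mainSamples]
    congr 2
    field_simp
    norm_num
  have hM1 : ∀ κ, 0 < κ → κ ≤ 1 / 8 → (1 : ℝ) ≤ M κ := fun κ h0 h1 => by
    have : 0 < M κ := Nat.ceil_pos.2 (mul_pos c.main_pos (by positivity))
    exact_mod_cast this
  have hcmp₁ : PolyBound 12 fun κ => (compareQueries c (θ κ / 4) 4 (δ κ / (4 * n κ)) : ℝ) := by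
    refine polyBound_compareQueries c hθ (PolyBound.const (by norm_num : (0 : ℝ) ≤ 4))
      ((((PolyBound.const (by norm_num : (0 : ℝ) ≤ 4)).mul hn).mul hδ).congr fun κ _ _ => ?_)
      fun κ h0 h1 => ?_
    · rw [one_div_div, mul_one_div]
    · rw [one_div_div, ← mul_one_div]
      have := hδ1 κ h0 h1
      have := hn1 κ h0 h1
      nlinarith
  have hcmp₂ : PolyBound 12 fun κ =>
      (compareQueries c (θ κ / 4) 4 (1 / (40 * (s κ : ℝ) * m κ)) : ℝ) := by
    refine polyBound_compareQueries c hθ (PolyBound.const (by norm_num : (0 : ℝ) ≤ 4))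
      ((((PolyBound.const (by norm_num : (0 : ℝ) ≤ 40)).mul hs).mul hm).congr fun κ _ _ => ?_)
      fun κ h0 h1 => ?_
    · rw [one_div_one_div]
    · rw [one_div_one_div]
      have := hs1 κ h0 h1
      have := hm1 κ h0 h1
      nlinarith
  have hcmp₃ : PolyBound 4 fun κ =>
      (compareQueries c (8 * κ / 2) (64 / (8 * κ) ^ 2) (1 / (10 * (M κ : ℝ))) : ℝ) := by
    refine polyBound_compareQueries c (b := 1) (k := 2) (((PolyBound.const
      (by norm_num : (0 : ℝ) ≤ 1 / 4)).mul (PolyBound.inv_pow 1)).congr fun κ h0 _ => ?_)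
      ((PolyBound.inv_pow 2).congr fun κ h0 _ => ?_)
      (((PolyBound.const (by norm_num : (0 : ℝ) ≤ 10)).mul hM).congr fun κ _ _ => ?_)
      fun κ h0 h1 => ?_
    · field_simp
      norm_num
    · field_simp
      norm_num
    · rw [one_div_one_div]
    · rw [one_div_one_div]
      linarith [hM1 κ h0 h1]
  refine ⟨fun κ => (s κ + s κ * ((n κ + n κ * compareQueries c (θ κ / 4) 4 (δ κ / (4 * n κ))) +
        m κ * compareQueries c (θ κ / 4) 4 (1 / (40 * (s κ : ℝ) * m κ)))) +
      M κ * compareQueries c (8 * κ / 2) (64 / (8 * κ) ^ 2) (1 / (10 * (M κ : ℝ))), ?_, ?_⟩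
  · exact (((hs.of_le (by norm_num)).add ((hs.mul (b' := 18)
      (((hn.of_le (by norm_num)).add ((hn.mul hcmp₁).of_le (by norm_num))).add
        ((hm.mul hcmp₂).of_le (by norm_num)))).of_le (by norm_num))).add
      ((hM.mul hcmp₃).of_le (by norm_num)))
  · intro ε hε0 hε N _
    have h8 : 8 * (ε / 8) = ε := by ring
    have h1 := queries_estimateDistUnif_le (N := N) c hε0 hε
    have h2 := queries_findReference_le (N := N) c (ε / 8) (s := s (ε / 8)) (β := β (ε / 8))
      (δ := δ (ε / 8)) (θ := θ (ε / 8)) (n := n (ε / 8)) (m := m (ε / 8)) rfl rfl rfl rfl rfl rfl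
    have h3 := h1.trans (Nat.add_le_add_right h2 _)
    simp only [M, h8]
    exact_mod_cast h3

theorem theorem7p2 :
    ∃ (c : ThetaConsts) (C₁ C₂ : ℝ) (a : ℕ),
      ∀ (ε : ℝ), 0 < ε → ε ≤ 1 → ∀ (N : ℕ) [NeZero N],
        ((estimateDistUnif c N ε).queries : ℝ) ≤
            C₂ * ((1 / ε) ^ 20 * Real.log (2 / ε) ^ a) ∧
        ∀ D : PMF (Fin N),
          2 / 3 ≤ (estimateDistUnif c N ε).outputProb D
            {d | |d - tvDist D (PMF.uniformOfFintype (Fin N))| ≤ C₁ * ε} := by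
  let c : ThetaConsts := ⟨1024, 2048, 5, 286720, 16, by norm_num, by norm_num, by norm_num,
    by norm_num, by norm_num⟩
  obtain ⟨q, hq, hqueries⟩ := polyBound_queries c
  obtain ⟨C, a, hC, hq⟩ := hq.exists_nonneg
  refine ⟨c, 6, C * 8 ^ 20 * 3 ^ a, a, fun ε hε0 hε N _ => ⟨?_, fun D => ?_⟩⟩
  · refine (hqueries ε hε0 hε N).trans ((hq (ε / 8) (by positivity) (by linarith)).2.trans ?_)
    have hL := two_le_log_inv (by positivity : 0 < ε / 8) (by linarith)
    -- Since ε ≤ 1, 8/ε = 4·(2/ε) ≤ (2/ε)³.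
    have hlog : Real.log (1 / (ε / 8)) ≤ 3 * Real.log (2 / ε) := by
      have h4 : 1 / (ε / 8) = 2 ^ 2 * (2 / ε) := by field_simp; norm_num
      have h2 : Real.log 2 ≤ Real.log (2 / ε) :=
        Real.log_le_log two_pos (by rw [le_div_iff₀ hε0]; linarith)
      rw [h4, Real.log_mul (by positivity) (by positivity), Real.log_pow]
      push_cast
      linarith
    calc C * ((1 / (ε / 8)) ^ 20 * Real.log (1 / (ε / 8)) ^ a)
        ≤ C * ((1 / (ε / 8)) ^ 20 * (3 * Real.log (2 / ε)) ^ a) := by gcongr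
      _ = _ := by
        rw [one_div_div, mul_pow, div_pow, div_pow]
        ring
  · have h := guarantee_estimateDistUnif (c := c) le_rfl le_rfl rfl le_rfl le_rfl D hε0 hε
    refine le_trans ?_ h.le_outputProb
    refine (ENNReal.le_ofReal_iff_toReal_le (by simp [ENNReal.div_eq_top]) (by norm_num)).2 ?_
    rw [ENNReal.toReal_div]
    norm_num
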